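/- Let $M$ be a (smooth, connected) complex projective manifold, let $\operatorname{Bir}(M)$ be its group of birational transformations, and let $\mathfrak X_{\mathrm{rat}}(M)$ be the Lie algebra of rational vector fields on $M$, i.e. the $\mathbb C$-linear derivations of the field of rational functions $\mathbb C(M)$ with the commutator bracket. An admissible open subset of $\mathbb C\times M$ is an open neighbourhood, for the Euclidean topology, of a set $\{0\}\times V$, where $V\subset M$ contains a non-empty Zariski open subset of $M$. A rational vector field $X$ is called birationally integrable if there are a morphism of groups $\phi\colon\mathbb C\to\operatorname{Bir}(M)$ and an admissible open subset $U\subset\mathbb C\times M$ on which the local flow $\varphi^X$ of $X$ (the local flow, in complex time, of the holomorphic vector field that $X$ defines outside its polar locus) is well-defined and such that for every $(t,p)\in U$ the birational map $\phi(t)$ is defined at $p$ and $\phi(t)(p)=\varphi^X_t(p)$. Let $\mathfrak X_{\mathrm{bir}}(M)\subset\mathfrak X_{\mathrm{rat}}(M)$ be the set of birationally integrable vector fields. Theorem. Let $\mathfrak g\subset\mathfrak X_{\mathrm{rat}}(M)$ be a finite-dimensional complex Lie subalgebra that is spanned, as a complex vector space, by birationally integrable vector fields. Then $\mathfrak g\subset\mathfrak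 X_{\mathrm{bir}}(M)$. -/

import Mathlib

open AlgebraicGeometry CategoryTheory Topology

noncomputable section

/-- The grading of the polynomial ring `ℂ[x₀, …, xₙ]` by the degree. -/
instance polynomialGrading (n : ℕ) :
    GradedAlgebra (MvPolynomial.homogeneousSubmodule (Fin (n + 1)) ℂ) :=
  MvPolynomial.gradedAlgebra

/-- Projective `n`-space over `ℂ`, as a scheme. -/
abbrev ComplexProjectiveSpace (n : ℕ) : Scheme.{0} :=
  Proj (MvPolynomial.homogeneousSubmodule (Fin (n + 1)) ℂ)

/-- The structure morphism of projective `n`-space over `ℂ`. -/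
def ComplexProjectiveSpace.toSpec (n : ℕ) :
    ComplexProjectiveSpace n ⟶ Spec (CommRingCat.of ℂ) :=
  Proj.toSpecZero (MvPolynomial.homogeneousSubmodule (Fin (n + 1)) ℂ) ≫
    Spec.map (CommRingCat.ofHom
      (algebraMap ℂ (MvPolynomial.homogeneousSubmodule (Fin (n + 1)) ℂ 0)))

/-- A (connected) complex projective manifold: an integral scheme, smooth over `ℂ`, which admits
a closed immersion over `ℂ` into some projective space. -/
structure ProjectiveManifold where
  /-- The underlying scheme. -/
  scheme : Scheme.{0}
  /-- The structure morphism. -/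
  str : scheme ⟶ Spec (CommRingCat.of ℂ)
  isIntegral : IsIntegral scheme
  smooth : Smooth str
  projective : ∃ (n : ℕ) (i : scheme ⟶ ComplexProjectiveSpace n),
    IsClosedImmersion i ∧ i ≫ ComplexProjectiveSpace.toSpec n = str

namespace ProjectiveManifold

instance (M : ProjectiveManifold) : IsIntegral M.scheme := M.isIntegral

instance (M : ProjectiveManifold) : Smooth M.str := M.smooth

instance (M : ProjectiveManifold) : M.scheme.Over (Spec (CommRingCat.of ℂ)) := ⟨M.str⟩

/-! ### Points, values of functions and the Euclidean topology -/

/-- The points of the manifold `M` are the closed points (equivalently, the `ℂ`-points) of the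
scheme.  This is a structure, and not a subtype, so that it does not inherit the Zariski
topology. -/
@[ext]
structure Point (M : ProjectiveManifold) where
  /-- The point of the scheme. -/
  pt : M.scheme
  isClosed : IsClosed ({pt} : Set M.scheme)

/-- The local ring `𝒪_p` of germs at `p` of regular functions. -/
abbrev LocalRing (M : ProjectiveManifold) (p : M.Point) : Type :=
  M.scheme.presheaf.stalk p.pt

/-- The value at `p` of a germ of regular function at `p`: its class in the residue field of `p`,
which is identified with `ℂ` through the structure morphism. -/
def evalGerm (M : ProjectiveManifold) (p : M.Point) : M.LocalRing p →+* ℂ :=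
  (residueFieldIsoBase M.str p.pt p.isClosed).hom.hom.comp (M.scheme.residue p.pt).hom

/-- The value at `p ∈ U` of a regular function on the Zariski open set `U`. -/
def evalSection (M : ProjectiveManifold) (U : M.scheme.Opens) (f : Γ(M.scheme, U)) (p : M.Point)
    (hp : p.pt ∈ U) : ℂ :=
  M.evalGerm p (M.scheme.presheaf.germ U p.pt hp f)

/-- The Euclidean topology on the points of `M`: the coarsest topology for which the Zariski open
sets are open and the regular functions on them are continuous. -/
instance euclideanTopology (M : ProjectiveManifold) : TopologicalSpace M.Point :=
  TopologicalSpace.generateFrom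
    {S | ∃ (U : M.scheme.Opens) (f : Γ(M.scheme, U)) (D : Set ℂ), IsOpen D ∧
      S = {p : M.Point | ∃ hp : p.pt ∈ U, M.evalSection U f p hp ∈ D}}

/-! ### Rational functions and rational vector fields -/

/-- The field `ℂ(M)` of rational functions. -/
abbrev RatFunc (M : ProjectiveManifold) : Type := M.scheme.functionField

/-- The field of rational functions is an algebra over `ℂ` through the structure morphism. -/
instance (M : ProjectiveManifold) : Algebra ℂ M.RatFunc :=
  ((Scheme.ΓSpecIso (CommRingCat.of ℂ)).inv ≫ M.str.appTop ≫
    M.scheme.presheaf.germ ⊤ (genericPoint M.scheme) trivial).hom.toAlgebra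

/-- A rational function is regular at `p` if it belongs to `𝒪_p ⊆ ℂ(M)`. -/
def IsRegularAt (M : ProjectiveManifold) (f : M.RatFunc) (p : M.Point) : Prop :=
  ∃ s : M.LocalRing p, algebraMap (M.LocalRing p) M.RatFunc s = f

open Classical in
/-- The value of a rational function at a point where it is regular (and `0` elsewhere). -/
def value (M : ProjectiveManifold) (f : M.RatFunc) (p : M.Point) : ℂ :=
  if h : M.IsRegularAt f p then M.evalGerm p h.choose else 0

/-- The Lie algebra of rational vector fields on `M`: the `ℂ`-linear derivations of the field of
rational functions, with the commutator bracket. -/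
abbrev RatVectorField (M : ProjectiveManifold) : Type :=
  Derivation ℂ M.RatFunc M.RatFunc

/-- A rational vector field is holomorphic at `p`, i.e. `p` is not in its polar locus, if it maps
germs of regular functions at `p` to germs of regular functions at `p`. -/
def IsHolomorphicAt (M : ProjectiveManifold) (X : M.RatVectorField) (p : M.Point) : Prop :=
  ∀ f : M.RatFunc, M.IsRegularAt f p → M.IsRegularAt (X f) p

/-! ### Birational transformations -/

/-- Dominant rational maps (over `ℂ`) from `M` to itself. -/
@[ext]
structure DominantRatMap (M : ProjectiveManifold) where
  /-- The rational map. -/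
  toRationalMap : M.scheme ⤏ M.scheme
  isDominant : toRationalMap.IsDominant
  isOver : toRationalMap.IsOver (Spec (CommRingCat.of ℂ))

instance (M : ProjectiveManifold) (f : M.DominantRatMap) : f.toRationalMap.IsDominant :=
  f.isDominant

instance (M : ProjectiveManifold) (f : M.DominantRatMap) :
    f.toRationalMap.IsOver (Spec (CommRingCat.of ℂ)) := f.isOver

/-- Dominant rational self-maps form a monoid, `f * g` being `f ∘ g` (first `g`, then `f`). -/
instance (M : ProjectiveManifold) : Monoid M.DominantRatMap where
  one := ⟨Scheme.RationalMap.id M.scheme, inferInstance, inferInstance⟩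
  mul f g := ⟨g.toRationalMap.comp f.toRationalMap, inferInstance, inferInstance⟩
  mul_assoc f g h := DominantRatMap.ext
    (Scheme.RationalMap.comp_assoc h.toRationalMap g.toRationalMap f.toRationalMap).symm
  one_mul f := DominantRatMap.ext (Scheme.RationalMap.comp_id f.toRationalMap)
  mul_one f := DominantRatMap.ext (Scheme.RationalMap.id_comp f.toRationalMap)

/-- The group `Bir(M)` of birational transformations: rational self-maps with a rational
inverse. -/
abbrev Bir (M : ProjectiveManifold) : Type := (M.DominantRatMap)ˣ

/-- `f` is defined at `p` and maps `p` to `q`. -/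
def MapsPoint (M : ProjectiveManifold) (f : M.Bir) (p q : M.Point) : Prop :=
  ∃ g : M.scheme.PartialMap M.scheme, g.toRationalMap = f.val.toRationalMap ∧
    ∃ hp : p.pt ∈ g.domain, g.hom ⟨p.pt, hp⟩ = q.pt

/-! ### Local flows and birational integrability -/

/-- `γ` solves at complex time `t` the differential equation defined by `X`: `X` is holomorphic
at `γ t` and the velocity of `γ` at time `t` is `X` at `γ t`, i.e. `(f ∘ γ)' (t) = (X f) (γ t)` for
every germ `f` of regular function at `γ t`. -/
def IsTangentAt (M : ProjectiveManifold) (X : M.RatVectorField) (γ : ℂ → M.Point) (t : ℂ) : Prop :=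
  ContinuousAt γ t ∧ M.IsHolomorphicAt X (γ t) ∧
    ∀ f : M.RatFunc, M.IsRegularAt f (γ t) →
      HasDerivAt (fun s => M.value f (γ s)) (M.value (X f) (γ t)) t

/-- An admissible open subset of `ℂ × M`: a Euclidean open neighbourhood of `{0} × V`, where
`V ⊆ M` contains a non-empty Zariski open subset. -/
def IsAdmissible (M : ProjectiveManifold) (U : Set (ℂ × M.Point)) : Prop :=
  IsOpen U ∧ ∃ W : M.scheme.Opens, (W : Set M.scheme).Nonempty ∧
    ∀ p : M.Point, p.pt ∈ W → ((0 : ℂ), p) ∈ U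

/-- The local flow of `X` is well-defined on `U` and it is given there by `ψ`.  For each `p`, the
set of times `t` with `(t, p) ∈ U` is, if non-empty, connected and contains `0`; on this set
`t ↦ ψ t p` is the solution of the differential equation defined by `X` with `ψ 0 p = p`;
and `ψ` is continuous on `U`. -/
structure IsLocalFlowOn (M : ProjectiveManifold) (X : M.RatVectorField) (U : Set (ℂ × M.Point))
    (ψ : ℂ → M.Point → M.Point) : Prop where
  zero_mem : ∀ t p, (t, p) ∈ U → ((0 : ℂ), p) ∈ U
  preconnected : ∀ p, IsPreconnected {t : ℂ | (t, p) ∈ U}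
  continuousOn : ContinuousOn (fun x : ℂ × M.Point => ψ x.1 x.2) U
  map_zero : ∀ p, ((0 : ℂ), p) ∈ U → ψ 0 p = p
  tangent : ∀ t p, (t, p) ∈ U → M.IsTangentAt X (fun s => ψ s p) t

/-- `X` is birationally integrable: there are a morphism of groups `φ : ℂ → Bir(M)` and an
admissible open set `U` on which the local flow `ψ` of `X` is well-defined and
`φ(t)(p) = ψ_t(p)` for all `(t, p) ∈ U`. -/
def IsBirationallyIntegrable (M : ProjectiveManifold) (X : M.RatVectorField) : Prop :=
  ∃ (φ : Multiplicative ℂ →* M.Bir) (U : Set (ℂ × M.Point)) (ψ : ℂ → M.Point → M.Point),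
    M.IsAdmissible U ∧ M.IsLocalFlowOn X U ψ ∧
      ∀ t p, (t, p) ∈ U → M.MapsPoint (φ (Multiplicative.ofAdd t)) p (ψ t p)

/-- The set of birationally integrable vector fields on `M`. -/
def birVectorFields (M : ProjectiveManifold) : Set M.RatVectorField :=
  {X | M.IsBirationallyIntegrable X}

end ProjectiveManifold

end

/-! ### Germs, values, and the action of birational maps on rational functions. -/

noncomputable section

namespace ProjectiveManifold

variable (M : ProjectiveManifold)

/-! Choose finitely many birationally integrable `x i` spanning the Lie algebra, with birational
flows `β i`. Bracketing with `x i` preserves the algebra, giving an operator `C i`, and for small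
times conjugation by the flow acts on the algebra as `exp (-t C i)`
(`IsFamily.exists_derivation_pullback`). Hence a product of the `β i (a i t)` is a family of
birational maps whose velocity stays in the algebra, computed by `productVelocity` (`IsFamily.mul`,
`exists_isFamily_list`). At `a = 0` this velocity is the sum of the `a' i • x i`, so it is onto, and
a holomorphic differential equation for `a` makes it equal to any prescribed constant `y`
(`exists_productVelocity_eq`). A birational family with constant velocity is the local flow of `y`,
hence a local homomorphism from a disc of `ℂ` to `Bir(M)` (`IsFamily.exists_map_add`), which extends
to `ℂ` (`exists_monoidHom_eq_on_ball`).

Two devices recur. The flows live only near time zero, for a duration depending on the point. Since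
`ℂ` is uncountable, one of countably many sets covering the points of a nonempty Zariski open set
must be Zariski dense (`exists_zariski_dense`). So a single duration works on a dense set of points,
and that suffices for identities between rational functions.

Pointwise identities in time need no local coordinates: they are proved for all functions regular on
the domain at once. Differentiating in time replaces `h` by `X h`, so all Taylor coefficients at
zero vanish together (`eq_zero_of_forall_hasDerivAt`). -/

/-- The image in the local ring at `x` of a complex number. -/
def constGerm (x : M.scheme) : ℂ →+* M.scheme.presheaf.stalk x :=
  ((Scheme.ΓSpecIso (CommRingCat.of ℂ)).inv ≫ M.str.appTop ≫
    M.scheme.presheaf.germ ⊤ x trivial).hom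

theorem specMap_constGerm (x : M.scheme) :
    Spec.map (CommRingCat.ofHom (M.constGerm x)) = M.scheme.fromSpecStalk x ≫ M.str := by
  have h : CommRingCat.ofHom (M.constGerm x) = (Scheme.ΓSpecIso (CommRingCat.of ℂ)).inv ≫
    M.str.appTop ≫ M.scheme.presheaf.germ ⊤ x trivial := rfl
  rw [h, Spec.map_comp, Spec.map_comp, ← Scheme.fromSpecStalk_toSpecΓ, Category.assoc,
    Category.assoc, ← Scheme.toSpecΓ_naturality_assoc]
  rw [← SpecMap_ΓSpecIso_hom, ← Spec.map_comp, Iso.inv_hom_id, Spec.map_id, Category.comp_id]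

theorem algebraMap_constGerm (x : M.scheme) (c : ℂ) :
    algebraMap (M.scheme.presheaf.stalk x) M.RatFunc (M.constGerm x c) =
      algebraMap ℂ M.RatFunc c := by
  have : Nonempty (⊤ : M.scheme.Opens) := ⟨⟨genericPoint M.scheme, trivial⟩⟩
  simp only [constGerm, CommRingCat.hom_comp, RingHom.comp_apply]
  erw [Scheme.algebraMap_germ_eq_germToFunctionField]
  rfl

/-- The inverse of the identification of the residue field with `ℂ` is the constants followed by
reduction, as both induce the structure morphism on the spectrum. -/
theorem evalGerm_constGerm (p : M.Point) (c : ℂ) : M.evalGerm p (M.constGerm p.pt c) = c := by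
  have h := SpecMap_residueFieldIsoBase_inv M.str p.pt p.isClosed
  have h2 : (residueFieldIsoBase M.str p.pt p.isClosed).inv =
      CommRingCat.ofHom (M.constGerm p.pt) ≫ M.scheme.residue p.pt := by
    apply Spec.map_injective
    rw [h, Spec.map_comp, specMap_constGerm, Scheme.fromSpecResidueField, Category.assoc]
  have h3 : (residueFieldIsoBase M.str p.pt p.isClosed).hom.hom
      ((residueFieldIsoBase M.str p.pt p.isClosed).inv.hom c) = c := by
    rw [← CommRingCat.comp_apply]; simp
  rw [h2] at h3
  exact h3

theorem evalGerm_eq_zero_iff (p : M.Point) (s : M.LocalRing p) :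
    M.evalGerm p s = 0 ↔ s ∈ IsLocalRing.maximalIdeal (M.LocalRing p) := by
  rw [← IsLocalRing.residue_eq_zero_iff]
  have : Function.Injective (residueFieldIsoBase M.str p.pt p.isClosed).hom.hom :=
    (ConcreteCategory.bijective_of_isIso (residueFieldIsoBase M.str p.pt p.isClosed).hom).1
  exact map_eq_zero_iff _ this

variable {M}

theorem value_algebraMap (p : M.Point) (s : M.LocalRing p) :
    M.value (algebraMap (M.LocalRing p) M.RatFunc s) p = M.evalGerm p s := by
  have h : M.IsRegularAt (algebraMap (M.LocalRing p) M.RatFunc s) p := ⟨s, rfl⟩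
  rw [value, dif_pos h]
  congr 1
  exact IsFractionRing.injective (M.LocalRing p) M.RatFunc h.choose_spec

theorem isRegularAt_algebraMap (c : ℂ) (p : M.Point) :
    M.IsRegularAt (algebraMap ℂ M.RatFunc c) p :=
  ⟨_, M.algebraMap_constGerm p.pt c⟩

theorem value_algebraMap_complex (c : ℂ) (p : M.Point) :
    M.value (algebraMap ℂ M.RatFunc c) p = c := by
  rw [← M.algebraMap_constGerm p.pt c, value_algebraMap, evalGerm_constGerm]

theorem IsRegularAt.add {f h : M.RatFunc} {p : M.Point} (hf : M.IsRegularAt f p)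
    (hh : M.IsRegularAt h p) : M.IsRegularAt (f + h) p := by
  obtain ⟨s, rfl⟩ := hf
  obtain ⟨t, rfl⟩ := hh
  exact ⟨s + t, map_add _ _ _⟩

theorem IsRegularAt.mul {f h : M.RatFunc} {p : M.Point} (hf : M.IsRegularAt f p)
    (hh : M.IsRegularAt h p) : M.IsRegularAt (f * h) p := by
  obtain ⟨s, rfl⟩ := hf
  obtain ⟨t, rfl⟩ := hh
  exact ⟨s * t, map_mul _ _ _⟩

theorem IsRegularAt.sub {f h : M.RatFunc} {p : M.Point} (hf : M.IsRegularAt f p)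
    (hh : M.IsRegularAt h p) : M.IsRegularAt (f - h) p := by
  obtain ⟨s, rfl⟩ := hf
  obtain ⟨t, rfl⟩ := hh
  exact ⟨s - t, map_sub _ _ _⟩

theorem IsRegularAt.smul {f : M.RatFunc} {p : M.Point} (c : ℂ) (hf : M.IsRegularAt f p) :
    M.IsRegularAt (c • f) p := by
  rw [Algebra.smul_def]
  exact (isRegularAt_algebraMap c p).mul hf

theorem isRegularAt_zero (p : M.Point) : M.IsRegularAt 0 p := ⟨0, map_zero _⟩

theorem value_zero (p : M.Point) : M.value 0 p = 0 := by
  simpa using value_algebraMap_complex (M := M) 0 p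

theorem value_add {f h : M.RatFunc} {p : M.Point} (hf : M.IsRegularAt f p)
    (hh : M.IsRegularAt h p) : M.value (f + h) p = M.value f p + M.value h p := by
  obtain ⟨s, rfl⟩ := hf
  obtain ⟨t, rfl⟩ := hh
  rw [← map_add, value_algebraMap, value_algebraMap, value_algebraMap, map_add]

theorem value_mul {f h : M.RatFunc} {p : M.Point} (hf : M.IsRegularAt f p)
    (hh : M.IsRegularAt h p) : M.value (f * h) p = M.value f p * M.value h p := by
  obtain ⟨s, rfl⟩ := hf
  obtain ⟨t, rfl⟩ := hh
  rw [← map_mul, value_algebraMap, value_algebraMap, value_algebraMap, map_mul]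

theorem value_sub {f h : M.RatFunc} {p : M.Point} (hf : M.IsRegularAt f p)
    (hh : M.IsRegularAt h p) : M.value (f - h) p = M.value f p - M.value h p := by
  obtain ⟨s, rfl⟩ := hf
  obtain ⟨t, rfl⟩ := hh
  rw [← map_sub, value_algebraMap, value_algebraMap, value_algebraMap, map_sub]

theorem value_smul {f : M.RatFunc} {p : M.Point} (c : ℂ) (hf : M.IsRegularAt f p) :
    M.value (c • f) p = c * M.value f p := by
  rw [Algebra.smul_def, value_mul (isRegularAt_algebraMap c p) hf, value_algebraMap_complex]

/-! ### Sections and the Euclidean topology -/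

theorem isRegularAt_germ {U : M.scheme.Opens} (hη : genericPoint M.scheme ∈ U)
    (f : Γ(M.scheme, U)) (p : M.Point) (hp : p.pt ∈ U) :
    M.IsRegularAt (M.scheme.presheaf.germ U (genericPoint M.scheme) hη f) p ∧
    M.value (M.scheme.presheaf.germ U (genericPoint M.scheme) hη f) p =
      M.evalSection U f p hp := by
  have : Nonempty U := ⟨⟨_, hp⟩⟩
  have h := Scheme.algebraMap_germ_eq_germToFunctionField (X := M.scheme) hp f
  change _ = M.scheme.presheaf.germ U (genericPoint M.scheme) hη f at h
  rw [← h]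
  exact ⟨⟨_, rfl⟩, value_algebraMap _ _⟩

theorem genericPoint_mem {U : M.scheme.Opens} {x : M.scheme} (hx : x ∈ U) :
    genericPoint M.scheme ∈ U :=
  ((genericPoint_spec M.scheme).mem_open_set_iff U.isOpen).mpr ⟨x, trivial, hx⟩

theorem IsRegularAt.exists_section {f : M.RatFunc} {p : M.Point} (hf : M.IsRegularAt f p) :
    ∃ (U : M.scheme.Opens) (hp : p.pt ∈ U) (s : Γ(M.scheme, U)),
      M.scheme.presheaf.germ U (genericPoint M.scheme) (genericPoint_mem hp) s = f := by
  obtain ⟨s, rfl⟩ := hf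
  obtain ⟨U, hp, s, rfl⟩ := M.scheme.presheaf.exists_germ_eq s
  have : Nonempty U := ⟨⟨_, hp⟩⟩
  exact ⟨U, hp, s, (Scheme.algebraMap_germ_eq_germToFunctionField (X := M.scheme) hp s).symm⟩

theorem isOpen_setOf_mem (U : M.scheme.Opens) : IsOpen {p : M.Point | p.pt ∈ U} := by
  apply TopologicalSpace.isOpen_generateFrom_of_mem
  refine ⟨U, 0, Set.univ, isOpen_univ, ?_⟩
  ext p
  simp

theorem IsRegularAt.eventually {f : M.RatFunc} {p : M.Point} (hf : M.IsRegularAt f p) :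
    ∀ᶠ q in 𝓝 p, M.IsRegularAt f q := by
  obtain ⟨U, hp, s, rfl⟩ := hf.exists_section
  filter_upwards [(isOpen_setOf_mem U).mem_nhds hp] with q hq
  exact (isRegularAt_germ _ s q hq).1

theorem IsRegularAt.continuousAt_value {f : M.RatFunc} {p : M.Point} (hf : M.IsRegularAt f p) :
    ContinuousAt (M.value f) p := by
  obtain ⟨U, hp, s, rfl⟩ := hf.exists_section
  rw [ContinuousAt, tendsto_nhds]
  intro D hD hpD
  rw [(isRegularAt_germ _ s p hp).2] at hpD
  have : IsOpen {q : M.Point | ∃ hq : q.pt ∈ U, M.evalSection U s q hq ∈ D} :=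
    TopologicalSpace.isOpen_generateFrom_of_mem ⟨U, s, D, hD, rfl⟩
  filter_upwards [this.mem_nhds ⟨hp, hpD⟩] with q hq
  obtain ⟨hq, h⟩ := hq
  rw [Set.mem_preimage, (isRegularAt_germ _ s q hq).2]
  exact h

/-! ### The action of birational transformations on rational functions -/

theorem hom_genericPoint (g : M.scheme.PartialMap M.scheme) [IsDominant g.hom]
    (hη : genericPoint M.scheme ∈ g.domain) :
    g.hom ⟨genericPoint M.scheme, hη⟩ = genericPoint M.scheme := by
  have : Nonempty g.domain := ⟨⟨_, hη⟩⟩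
  have h1 : (⟨genericPoint M.scheme, hη⟩ : g.domain) = genericPoint g.domain := by
    apply Subtype.ext
    exact (genericPoint_eq_of_isOpenImmersion g.domain.ι).symm
  rw [h1]
  have h2 := (genericPoint_spec g.domain).image g.hom.continuous
  rw [Set.image_univ, g.hom.denseRange.closure_range] at h2
  exact h2.eq (genericPoint_spec M.scheme)

/-- The stalk map of `ι` is invertible, so the stalk map of `f` can be made to land in a stalk of
`X`. This serves partial maps, whose domain is an open subscheme. -/
theorem exists_stalkHom_of_isOpenImmersion {X Y U : Scheme.{0}} (ι : U ⟶ X) [IsOpenImmersion ι]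
    (f : U ⟶ Y) (z : U) (β : Spec (X.presheaf.stalk (ι z)) ⟶ U)
    (hβ : β ≫ ι = X.fromSpecStalk (ι z)) :
    ∃ α : Y.presheaf.stalk (f z) ⟶ X.presheaf.stalk (ι z), IsLocalHom α.hom ∧
      Spec.map α ≫ Y.fromSpecStalk (f z) = β ≫ f := by
  refine ⟨f.stalkMap z ≫ inv (ι.stalkMap z), ?_, ?_⟩
  · rw [CommRingCat.hom_comp]
    have h1 : IsLocalHom (inv (ι.stalkMap z)).hom := inferInstance
    have h2 : IsLocalHom (f.stalkMap z).hom := inferInstance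
    exact RingHom.isLocalHom_comp _ _
  · rw [Spec.map_comp, Category.assoc, Scheme.SpecMap_stalkMap_fromSpecStalk, ← Category.assoc]
    congr 1
    rw [← cancel_mono ι, hβ, Category.assoc, ← Scheme.SpecMap_stalkMap_fromSpecStalk,
      ← Spec.map_comp_assoc, IsIso.hom_inv_id, Spec.map_id, Category.id_comp]

theorem exists_stalkHom (g : M.scheme.PartialMap M.scheme) {x y : M.scheme} (hx : x ∈ g.domain)
    (hy : g.hom ⟨x, hx⟩ = y) :
    ∃ α : M.scheme.presheaf.stalk y ⟶ M.scheme.presheaf.stalk x, IsLocalHom α.hom ∧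
      Spec.map α ≫ M.scheme.fromSpecStalk y = g.fromSpecStalkOfMem hx := by
  subst hy
  exact exists_stalkHom_of_isOpenImmersion g.domain.ι g.hom ⟨x, hx⟩
    (g.domain.fromSpecStalkOfMem x hx) (g.domain.fromSpecStalkOfMem_ι x hx)

theorem fromSpecStalkOfMem_specializes (g : M.scheme.PartialMap M.scheme) {x y : M.scheme}
    (hx : x ∈ g.domain) (hy : y ∈ g.domain) (h : y ⤳ x) :
    Spec.map (M.scheme.presheaf.stalkSpecializes h) ≫ g.fromSpecStalkOfMem hx =
      g.fromSpecStalkOfMem hy := by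
  simp only [Scheme.PartialMap.fromSpecStalkOfMem, ← Category.assoc]
  congr 1
  rw [← cancel_mono g.domain.ι]
  simp

theorem exists_pullback (f : M.DominantRatMap) :
    ∃ α : M.scheme.functionField ⟶ M.scheme.functionField,
      Spec.map α ≫ M.scheme.fromSpecStalk (genericPoint M.scheme) =
        f.toRationalMap.fromFunctionField := by
  obtain ⟨g, hg⟩ := f.toRationalMap.exists_rep
  have hd : IsDominant g.hom := by
    rw [← Scheme.PartialMap.isDominant_toRationalMap_iff, hg]
    exact f.isDominant
  have hη := genericPoint_mem g.dense_domain.nonempty.choose_spec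
  obtain ⟨α, -, hα⟩ := exists_stalkHom g hη (hom_genericPoint g hη)
  exact ⟨α, by rw [hα, ← hg]; rfl⟩

/-- The action of a dominant rational map on rational functions, as a morphism. -/
def pullbackHom (f : M.DominantRatMap) : M.scheme.functionField ⟶ M.scheme.functionField :=
  (exists_pullback f).choose

theorem specMap_pullbackHom (f : M.DominantRatMap) :
    Spec.map (pullbackHom f) ≫ M.scheme.fromSpecStalk (genericPoint M.scheme) =
      f.toRationalMap.fromFunctionField :=
  (exists_pullback f).choose_spec

/-- The action of a dominant rational map on rational functions, `h ↦ h ∘ f`. -/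
def pullback (f : M.DominantRatMap) : M.RatFunc →+* M.RatFunc :=
  (pullbackHom f).hom

/-- A rational map is determined by its restriction to the generic point. Equalities in `Bir(M)`
thereby become equalities of field endomorphisms. -/
theorem pullback_injective : Function.Injective (pullback (M := M)) := by
  intro f g h
  apply DominantRatMap.ext
  apply Scheme.RationalMap.eq_of_fromFunctionField_eq
  have h' : pullbackHom f = pullbackHom g := CommRingCat.hom_ext h
  rw [← specMap_pullbackHom, ← specMap_pullbackHom, h']

theorem pullback_algebraMap (f : M.DominantRatMap) (g : M.scheme.PartialMap M.scheme)
    (hg : g.toRationalMap = f.toRationalMap) {x y : M.scheme} (hx : x ∈ g.domain)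
    (α : M.scheme.presheaf.stalk y ⟶ M.scheme.presheaf.stalk x)
    (hα : Spec.map α ≫ M.scheme.fromSpecStalk y = g.fromSpecStalkOfMem hx)
    (s : M.scheme.presheaf.stalk y) :
    pullback f (algebraMap (M.scheme.presheaf.stalk y) M.RatFunc s) =
      algebraMap (M.scheme.presheaf.stalk x) M.RatFunc (α s) := by
  have hη := genericPoint_mem hx
  have hs (z : M.scheme) : genericPoint M.scheme ⤳ z :=
    (genericPoint_spec M.scheme).specializes trivial
  have h : M.scheme.presheaf.stalkSpecializes (hs y) ≫ pullbackHom f =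
      α ≫ M.scheme.presheaf.stalkSpecializes (hs x) := by
    apply Spec.map_injective
    rw [← cancel_mono (M.scheme.fromSpecStalk y)]
    rw [Spec.map_comp, Spec.map_comp, Category.assoc, Category.assoc, hα,
      fromSpecStalkOfMem_specializes g hx hη, Scheme.SpecMap_stalkSpecializes_fromSpecStalk,
      specMap_pullbackHom, ← hg]
    rfl
  exact congr($h s)

theorem pullback_one : pullback (1 : M.DominantRatMap) = RingHom.id M.RatFunc := by
  have h : pullbackHom (1 : M.DominantRatMap) = 𝟙 M.scheme.functionField := by
    apply Spec.map_injective
    rw [← cancel_mono (M.scheme.fromSpecStalk (genericPoint M.scheme)), specMap_pullbackHom,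
      Spec.map_id, Category.id_comp]
    change (𝟙 M.scheme : M.scheme ⟶ M.scheme).toPartialMap.fromSpecStalkOfMem trivial = _
    rw [Scheme.PartialMap.fromSpecStalkOfMem_toPartialMap, Category.comp_id]
  exact congr(($h).hom)

/-! ### Points -/

theorem comp_hom_apply (f g : M.scheme.PartialMap M.scheme) [IsDominant f.hom] {x y : M.scheme}
    (hx : x ∈ f.domain) (hy : y ∈ g.domain) (hxy : f.hom ⟨x, hx⟩ = y)
    (hfg : x ∈ (f.comp g).domain) : (f.comp g).hom ⟨x, hfg⟩ = g.hom ⟨y, hy⟩ := by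
  set W := f.domain.ι ''ᵁ f.hom ⁻¹ᵁ g.domain
  let z : W := ⟨x, hfg⟩
  let w := (f.domain.ι.isoImage (f.hom ⁻¹ᵁ g.domain)).inv z
  have h1 : f.domain.ι ((f.hom ⁻¹ᵁ g.domain).ι w) = x :=
    congr($(f.domain.ι.isoImage_inv_ι (f.hom ⁻¹ᵁ g.domain)) z)
  have h2 : (f.hom ⁻¹ᵁ g.domain).ι w = (⟨x, hx⟩ : f.domain) := Subtype.ext h1
  have h3 : g.domain.ι ((f.hom ∣_ g.domain) w) = y := by
    have := congr($(morphismRestrict_ι f.hom g.domain) w)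
    rw [Scheme.Hom.comp_apply, Scheme.Hom.comp_apply] at this
    rw [this, ← hxy]
    exact congrArg f.hom h2
  have h4 : (f.hom ∣_ g.domain) w = (⟨y, hy⟩ : g.domain) := Subtype.ext h3
  exact congrArg g.hom h4

theorem MapsPoint.comp {f g : M.Bir} {p q r : M.Point} (hg : M.MapsPoint g p q)
    (hf : M.MapsPoint f q r) : M.MapsPoint (f * g) p r := by
  obtain ⟨g', hg, hp, hpq⟩ := hg
  obtain ⟨f', hf, hq, hqr⟩ := hf
  have hd : IsDominant g'.hom := by
    rw [← Scheme.PartialMap.isDominant_toRationalMap_iff, hg]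
    exact g.val.isDominant
  refine ⟨g'.comp f', ?_, ⟨⟨p.pt, hp⟩, ?_, rfl⟩, ?_⟩
  · rw [← Scheme.RationalMap.toRationalMap_comp]
    change _ = g.val.toRationalMap.comp f.val.toRationalMap
    congr 1
  · change g'.hom ⟨p.pt, hp⟩ ∈ f'.domain
    rwa [hpq]
  · rw [← hqr]
    exact comp_hom_apply g' f' hp hq hpq _

theorem MapsPoint.one (p : M.Point) : M.MapsPoint 1 p p :=
  ⟨Scheme.PartialMap.id M.scheme, rfl, trivial, rfl⟩

/-- Subtracting its value from `s` gives an element of the maximal ideal; the stalk map is local and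
fixes constants, so values are preserved. -/
theorem MapsPoint.exists_germ {f : M.Bir} {p q : M.Point} (hf : M.MapsPoint f p q)
    (s : M.LocalRing q) : ∃ t : M.LocalRing p,
      pullback f.val (algebraMap (M.LocalRing q) M.RatFunc s) =
        algebraMap (M.LocalRing p) M.RatFunc t ∧ M.evalGerm p t = M.evalGerm q s := by
  obtain ⟨g, hg, hp, hpq⟩ := hf
  obtain ⟨α, hloc, hα⟩ := exists_stalkHom g hp hpq
  refine ⟨α s, pullback_algebraMap f.val g hg hp α hα s, ?_⟩
  have hover : g.IsOver (Spec (CommRingCat.of ℂ)) := by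
    rw [← Scheme.PartialMap.isOver_toRationalMap_iff_of_isSeparated, hg]
    exact f.val.isOver
  have hconst : CommRingCat.ofHom (M.constGerm q.pt) ≫ α =
      CommRingCat.ofHom (M.constGerm p.pt) := by
    apply Spec.map_injective
    rw [Spec.map_comp, specMap_constGerm, specMap_constGerm, reassoc_of% hα,
      Scheme.PartialMap.fromSpecStalkOfMem, Category.assoc]
    have h1 : g.hom ≫ M.str = g.domain.ι ≫ M.str := hover.1
    rw [h1, Scheme.Opens.fromSpecStalkOfMem_ι_assoc]
  set c := M.evalGerm q s with hc
  have h1 : M.evalGerm q (s - M.constGerm q.pt c) = 0 := by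
    rw [map_sub, evalGerm_constGerm, sub_self]
  rw [evalGerm_eq_zero_iff] at h1
  have h2 : M.evalGerm p (α (s - M.constGerm q.pt c)) = 0 := by
    rw [evalGerm_eq_zero_iff]
    exact map_nonunit α.hom _ h1
  have h3 : α (M.constGerm q.pt c) = M.constGerm p.pt c := congr($hconst c)
  rw [map_sub, map_sub, h3, evalGerm_constGerm, sub_eq_zero] at h2
  exact h2

theorem MapsPoint.isRegularAt {f : M.Bir} {p q : M.Point} (hf : M.MapsPoint f p q)
    {h : M.RatFunc} (hh : M.IsRegularAt h q) : M.IsRegularAt (pullback f.val h) p := by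
  obtain ⟨s, rfl⟩ := hh
  obtain ⟨t, ht, -⟩ := hf.exists_germ s
  exact ⟨t, ht.symm⟩

theorem MapsPoint.value_pullback {f : M.Bir} {p q : M.Point} (hf : M.MapsPoint f p q)
    {h : M.RatFunc} (hh : M.IsRegularAt h q) :
    M.value (pullback f.val h) p = M.value h q := by
  obtain ⟨s, rfl⟩ := hh
  obtain ⟨t, ht, h⟩ := hf.exists_germ s
  rw [ht, value_algebraMap, value_algebraMap, h]

end ProjectiveManifold
end

/-! ### Zariski density from countable covers. -/

noncomputable section

open Cardinal in
/-- A countably generated field extension of `ℂ` (as an algebra) is trivial. -/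
theorem algebraMap_complex_bijective_of_rank_le {L : Type} [Field L] [Algebra ℂ L]
    (h : Module.rank ℂ L ≤ ℵ₀) : Function.Bijective (algebraMap ℂ L) := by
  have : Algebra.IsAlgebraic ℂ L := by
    by_contra hna
    obtain ⟨x, hx⟩ : ∃ x : L, Transcendental ℂ x := by
      by_contra! h'
      exact hna ⟨fun x => by simpa [Transcendental] using h' x⟩
    -- For `x` transcendental, the inverses of `x - c`, with `c` in `ℂ`, are linearly independent:
    -- continuum many vectors.
    have h2 := hx.linearIndependent_sub_inv.cardinal_le_rank
    rw [Cardinal.mk_complex] at h2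
    exact absurd (h2.trans h) (not_le.mpr aleph0_lt_continuum)
  exact IsAlgClosed.algebraMap_bijective_of_isIntegral

open Cardinal in
-- Inverting all the `a n` gives an algebra of countable dimension. Its quotient by a maximal ideal
-- is `ℂ`, and each `a n` maps to a unit there.
theorem exists_algHom_complex_forall_ne_zero {R : Type} [CommRing R] [IsDomain R] [Algebra ℂ R]
    [Algebra.FiniteType ℂ R] (a : ℕ → R) (ha : ∀ n, a n ≠ 0) :
    ∃ χ : R →ₐ[ℂ] ℂ, ∀ n, χ (a n) ≠ 0 := by
  obtain ⟨s, hs⟩ := Algebra.FiniteType.out (R := ℂ) (A := R)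
  let K := FractionRing R
  let c : Set K := (algebraMap R K '' (s : Set R)) ∪ Set.range fun n => (algebraMap R K (a n))⁻¹
  let B := Algebra.adjoin ℂ c
  have hc : c.Countable :=
    (s.finite_toSet.countable.image _).union (Set.countable_range _)
  have hB : Module.rank ℂ B ≤ ℵ₀ :=
    (Algebra.rank_adjoin_le c).trans (max_le (Cardinal.le_aleph0_iff_set_countable.mpr hc) le_rfl)
  have hR (r : R) : algebraMap R K r ∈ B := by
    have h1 : (⊤ : Subalgebra ℂ R) ≤ B.comap (IsScalarTower.toAlgHom ℂ R K) := by
      rw [← hs, Algebra.adjoin_le_iff]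
      intro x hx
      exact Algebra.subset_adjoin (Or.inl ⟨x, hx, rfl⟩)
    exact h1 (Algebra.mem_top (x := r))
  let ι : R →ₐ[ℂ] B := (IsScalarTower.toAlgHom ℂ R K).codRestrict B hR
  obtain ⟨m, hm⟩ := Ideal.exists_maximal B
  let : Field (B ⧸ m) := Ideal.Quotient.field m
  have hL : Module.rank ℂ (B ⧸ m) ≤ ℵ₀ :=
    (LinearMap.rank_le_of_surjective (Ideal.Quotient.mkₐ ℂ m).toLinearMap
      (Ideal.Quotient.mkₐ_surjective ℂ m)).trans hB
  let e := AlgEquiv.ofBijective (Algebra.ofId ℂ (B ⧸ m))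
    (algebraMap_complex_bijective_of_rank_le hL)
  refine ⟨e.symm.toAlgHom.comp ((Ideal.Quotient.mkₐ ℂ m).comp ι), fun n => ?_⟩
  have hu : IsUnit (ι (a n)) := by
    refine IsUnit.of_mul_eq_one
      ⟨(algebraMap R K (a n))⁻¹, Algebra.subset_adjoin (Or.inr ⟨n, rfl⟩)⟩ ?_
    apply Subtype.ext
    exact mul_inv_cancel₀
      (by simpa using ha n : algebraMap R K (a n) ≠ 0)
  exact (hu.map (e.symm.toAlgHom.comp (Ideal.Quotient.mkₐ ℂ m))).ne_zero

namespace ProjectiveManifold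

variable {M : ProjectiveManifold}

theorem evalSection_eq_zero_iff {U : M.scheme.Opens} (f : Γ(M.scheme, U)) (p : M.Point)
    (hp : p.pt ∈ U) : M.evalSection U f p hp = 0 ↔ p.pt ∉ M.scheme.basicOpen f := by
  rw [evalSection, evalGerm_eq_zero_iff, IsLocalRing.mem_maximalIdeal, mem_nonunits_iff,
    Scheme.mem_basicOpen _ _ _ hp]

instance : JacobsonSpace M.scheme := LocallyOfFiniteType.jacobsonSpace M.str

theorem exists_point_of_isMaximal {A : M.scheme.Opens} (hA : IsAffineOpen A)
    (m : Ideal Γ(M.scheme, A)) (hm : m.IsMaximal) :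
    ∃ (p : M.Point) (hp : p.pt ∈ A), ∀ f, M.evalSection A f p hp = 0 ↔ f ∈ m := by
  let z : PrimeSpectrum Γ(M.scheme, A) := ⟨m, hm.isPrime⟩
  have hz : IsClosed ({z} : Set (PrimeSpectrum Γ(M.scheme, A))) :=
    z.isClosed_singleton_iff_isMaximal.mpr hm
  let x : M.scheme := hA.fromSpec z
  have hx : x ∈ A := by
    have : x ∈ Set.range hA.fromSpec := ⟨z, rfl⟩
    rwa [hA.range_fromSpec] at this
  have hc : IsClosed ({x} : Set M.scheme) := by
    apply isClosed_singleton_of_isLocallyClosed_singleton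
    rw [show ({x} : Set M.scheme) = hA.fromSpec '' {z} from
      (Set.image_singleton (f := hA.fromSpec) (a := z)).symm]
    exact IsLocallyClosed.image hz.isLocallyClosed hA.fromSpec.isOpenEmbedding.isInducing
      hA.fromSpec.isOpenEmbedding.isOpen_range.isLocallyClosed
  refine ⟨⟨x, hc⟩, hx, fun f => ?_⟩
  rw [evalSection_eq_zero_iff]
  change z ∉ hA.fromSpec ⁻¹ᵁ M.scheme.basicOpen f ↔ _
  rw [hA.fromSpec_preimage_basicOpen]
  exact not_not

theorem exists_forall_evalSection_ne_zero {A : M.scheme.Opens} (hA : IsAffineOpen A) [Nonempty A]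
    (a : ℕ → Γ(M.scheme, A)) (ha : ∀ n, a n ≠ 0) :
    ∃ (p : M.Point) (hp : p.pt ∈ A), ∀ n, M.evalSection A (a n) p hp ≠ 0 := by
  let φ : CommRingCat.of ℂ ⟶ Γ(M.scheme, A) :=
    (Scheme.ΓSpecIso (CommRingCat.of ℂ)).inv ≫ M.str.appLE ⊤ A le_top
  have hφ : φ.hom.FiniteType := by
    have h1 : (M.str.appLE ⊤ A le_top).hom.FiniteType :=
      HasRingHomProperty.appLE @LocallyOfFiniteType M.str inferInstance ⟨⊤, isAffineOpen_top _⟩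
        ⟨A, hA⟩ le_top
    rw [CommRingCat.hom_comp]
    exact h1.comp (RingHom.FiniteType.of_surjective _ (ConcreteCategory.bijective_of_isIso
      (Scheme.ΓSpecIso (CommRingCat.of ℂ)).inv).2)
  let : Algebra ℂ Γ(M.scheme, A) := φ.hom.toAlgebra
  have : Algebra.FiniteType ℂ Γ(M.scheme, A) := hφ
  obtain ⟨χ, hχ⟩ := exists_algHom_complex_forall_ne_zero a ha
  have hsurj : Function.Surjective χ.toRingHom := fun c => ⟨algebraMap ℂ _ c, χ.commutes c⟩
  obtain ⟨p, hp, h⟩ := exists_point_of_isMaximal hA (RingHom.ker χ.toRingHom)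
    (RingHom.ker_isMaximal_of_surjective _ hsurj)
  exact ⟨p, hp, fun n h0 => hχ n ((h (a n)).mp h0)⟩

/-- If the points of a nonempty Zariski open set are covered by countably many sets, then one of
these sets is Zariski dense. -/
theorem exists_zariski_dense {W : M.scheme.Opens} (hW : (W : Set M.scheme).Nonempty)
    (P : ℕ → Set M.Point) (hP : ∀ p : M.Point, p.pt ∈ W → ∃ n, p ∈ P n) :
    ∃ n, ∀ h : M.RatFunc,
      (∀ p ∈ P n, p.pt ∈ W → M.IsRegularAt h p ∧ M.value h p = 0) → h = 0 := by
  -- Otherwise each `P n` carries a nonzero `h n` vanishing on it; a point avoiding the zeros of all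
  -- their numerators lies in no `P n`.
  by_contra! hcon
  choose h hh h0 using hcon
  obtain ⟨x, hx⟩ := hW
  obtain ⟨_, ⟨A, hA, rfl⟩, hxA, hAW⟩ :=
    M.scheme.isBasis_affineOpens.exists_subset_of_mem_open hx W.isOpen
  have : Nonempty A := ⟨⟨x, hxA⟩⟩
  have := functionField_isFractionRing_of_isAffineOpen M.scheme A hA
  have hη : genericPoint M.scheme ∈ A := genericPoint_mem hxA
  have hfrac (n) : ∃ a b : Γ(M.scheme, A), b ≠ 0 ∧
      M.scheme.presheaf.germ A _ hη a = h n * M.scheme.presheaf.germ A _ hη b := by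
    obtain ⟨a, b, hb, hab⟩ := IsFractionRing.div_surjective Γ(M.scheme, A) (h n)
    have hb0 : b ≠ 0 := nonZeroDivisors.ne_zero hb
    refine ⟨a, b, hb0, ?_⟩
    change algebraMap Γ(M.scheme, A) M.RatFunc a = h n * algebraMap Γ(M.scheme, A) M.RatFunc b
    rw [← hab, div_mul_cancel₀]
    simpa using hb0
  choose a b hb hab using hfrac
  have ha (n) : a n ≠ 0 := by
    intro ha0
    have := hab n
    rw [ha0, map_zero] at this
    rcases mul_eq_zero.mp this.symm with h1 | h1
    · exact h0 n h1
    · exact hb n (germ_injective_of_isIntegral _ _ hη (by rw [h1, map_zero]))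
  obtain ⟨p, hp, hne⟩ := exists_forall_evalSection_ne_zero hA a ha
  obtain ⟨n, hn⟩ := hP p (hAW hp)
  obtain ⟨hreg, hval⟩ := hh n p hn (hAW hp)
  apply hne n
  rw [← (isRegularAt_germ hη (a n) p hp).2, hab, value_mul hreg (isRegularAt_germ hη (b n) p hp).1,
    hval, zero_mul]

theorem exists_point_mem {W : M.scheme.Opens} (hW : (W : Set M.scheme).Nonempty) :
    ∃ p : M.Point, p.pt ∈ W := by
  by_contra! hne
  obtain ⟨-, hn⟩ := exists_zariski_dense hW (fun _ => ∅) fun p hp => (hne p hp).elim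
  exact one_ne_zero (hn 1 fun p _ hp => (hne p hp).elim)

end ProjectiveManifold
end

/-! ### Tools from complex analysis. -/

noncomputable section

open Metric in
/-- A family of functions on a disc, each of whose derivatives belongs to the family, vanishes if
all its members vanish at the centre. -/
theorem eq_zero_of_forall_hasDerivAt {ι : Type*} (Φ : ι → ℂ → ℂ) (D : ι → ι) {r : ℝ}
    (hΦ : ∀ i, ∀ t ∈ ball (0 : ℂ) r, HasDerivAt (Φ i) (Φ (D i) t) t) (h0 : ∀ i, Φ i 0 = 0)
    (i : ι) {t : ℂ} (ht : t ∈ ball (0 : ℂ) r) : Φ i t = 0 := by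
  have key : ∀ n : ℕ, ∀ t ∈ ball (0 : ℂ) r, iteratedDeriv n (Φ i) t = Φ (D^[n] i) t := by
    intro n
    induction n with
    | zero => intro t _; simp
    | succ n ih =>
      intro t ht
      rw [iteratedDeriv_succ, Function.iterate_succ_apply']
      have : iteratedDeriv n (Φ i) =ᶠ[𝓝 t] Φ (D^[n] i) := by
        filter_upwards [isOpen_ball.mem_nhds ht] with s hs using ih s hs
      rw [this.deriv_eq, (hΦ _ t ht).deriv]
  have hd : DifferentiableOn ℂ (Φ i) (ball 0 r) :=
    fun s hs => (hΦ i s hs).differentiableAt.differentiableWithinAt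
  have hr : (0 : ℂ) ∈ ball (0 : ℂ) r := mem_ball_self (dist_nonneg.trans_lt ht)
  rw [← Complex.taylorSeries_eq_on_ball hd ht]
  simp [key _ 0 hr, h0]

open Metric in
/-- Differentiation with respect to a parameter commutes with the complex derivative. -/
theorem hasDerivAt_deriv_of_hasDerivAt {F F' : ℂ → ℂ → ℂ} {r : ℝ} (hr : 0 < r)
    (hF : ∀ t ∈ ball (0 : ℂ) r, DifferentiableOn ℂ (F t) (ball 0 r))
    (hF' : ∀ t ∈ ball (0 : ℂ) r, DifferentiableOn ℂ (F' t) (ball 0 r))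
    (hcont : ContinuousOn (fun x : ℂ × ℂ => F' x.1 x.2) (ball 0 r ×ˢ ball 0 r))
    (hderiv : ∀ t ∈ ball (0 : ℂ) r, ∀ s ∈ ball (0 : ℂ) r,
      HasDerivAt (fun u => F u s) (F' t s) t)
    {t : ℂ} (ht : t ∈ ball (0 : ℂ) r) :
    HasDerivAt (fun u => deriv (F u) 0) (deriv (F' t) 0) t := by
  set ρ := r / 2 with hρ
  have hρ0 : 0 < ρ := half_pos hr
  have hsub : closedBall (0 : ℂ) ρ ⊆ ball 0 r := closedBall_subset_ball (half_lt_self hr)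
  -- Cauchy's formula turns the derivative in the parameter into an integral over a fixed circle,
  -- under which one may differentiate in time.
  have hcauchy : ∀ f : ℂ → ℂ, DifferentiableOn ℂ f (ball 0 r) →
      deriv f 0 = (2 * Real.pi * Complex.I : ℂ)⁻¹ • ∮ z in C(0, ρ), ((z - 0) ^ 2)⁻¹ • f z :=
    fun f hf => (Complex.two_pi_I_inv_smul_circleIntegral_sub_sq_inv_smul_of_differentiable
      isOpen_ball hsub hf (mem_ball_self hρ0)).symm
  have hcm (θ : ℝ) : circleMap 0 ρ θ ∈ ball (0 : ℂ) r :=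
    hsub (circleMap_mem_closedBall 0 hρ0.le θ)
  obtain ⟨ε, hε, hεr⟩ : ∃ ε > 0, closedBall t ε ⊆ ball 0 r :=
    nhds_basis_closedBall.mem_iff.mp (isOpen_ball.mem_nhds ht)
  let w : ℝ → ℂ := fun θ => deriv (circleMap 0 ρ) θ * ((circleMap 0 ρ θ - 0) ^ 2)⁻¹
  have hw : Continuous w := by
    have h1 : Continuous (deriv (circleMap (0 : ℂ) ρ)) := by
      rw [funext (deriv_circleMap (0 : ℂ) ρ)]
      exact (continuous_circleMap 0 ρ).mul continuous_const
    refine h1.mul (Continuous.inv₀ (((continuous_circleMap 0 ρ).sub continuous_const).pow 2) ?_)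
    intro θ
    rw [sub_zero]
    exact pow_ne_zero 2 (circleMap_ne_center hρ0.ne')
  have hcurve (f : ℂ → ℂ) (hf : DifferentiableOn ℂ f (ball 0 r)) :
      Continuous fun θ => f (circleMap 0 ρ θ) :=
    hf.continuousOn.comp_continuous (continuous_circleMap 0 ρ) hcm
  have hcF' : ContinuousOn (fun x : ℂ × ℂ => F' x.1 x.2) (closedBall t ε ×ˢ closedBall 0 ρ) :=
    hcont.mono (Set.prod_mono hεr hsub)
  obtain ⟨C, hC⟩ := ((isCompact_closedBall t ε).prod
    (isCompact_closedBall (0 : ℂ) ρ)).exists_bound_of_continuousOn hcF'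
  have hint : HasDerivAt (fun u => ∫ θ in (0 : ℝ)..2 * Real.pi, w θ * F u (circleMap 0 ρ θ))
      (∫ θ in (0 : ℝ)..2 * Real.pi, w θ * F' t (circleMap 0 ρ θ)) t := by
    refine (intervalIntegral.hasDerivAt_integral_of_dominated_loc_of_deriv_le (𝕜 := ℂ)
      (F := fun u θ => w θ * F u (circleMap 0 ρ θ))
      (F' := fun u θ => w θ * F' u (circleMap 0 ρ θ)) (bound := fun θ => ‖w θ‖ * C)
      (closedBall_mem_nhds t hε) ?_ ?_ ?_ ?_ ?_ ?_).2
    · filter_upwards [isOpen_ball.mem_nhds ht] with u hu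
      exact (hw.mul (hcurve _ (hF u hu))).aestronglyMeasurable
    · exact (hw.mul (hcurve _ (hF t ht))).intervalIntegrable _ _
    · exact (hw.mul (hcurve _ (hF' t ht))).aestronglyMeasurable
    · refine Filter.Eventually.of_forall fun θ _ u hu => ?_
      rw [norm_mul]
      gcongr
      exact hC (u, circleMap 0 ρ θ) ⟨hu, circleMap_mem_closedBall 0 hρ0.le θ⟩
    · exact (hw.norm.mul continuous_const).intervalIntegrable _ _
    · exact Filter.Eventually.of_forall fun θ _ u hu =>
        (hderiv u (hεr hu) _ (hcm θ)).const_mul (w θ)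
  have hcircle (f : ℂ → ℂ) : ∮ z in C(0, ρ), ((z - 0) ^ 2)⁻¹ • f z =
      ∫ θ in (0 : ℝ)..2 * Real.pi, w θ * f (circleMap 0 ρ θ) := by
    simp only [circleIntegral, smul_eq_mul, w, mul_assoc]
  rw [hcauchy _ (hF' t ht), hcircle]
  refine (hint.const_smul (2 * Real.pi * Complex.I : ℂ)⁻¹).congr_of_eventuallyEq ?_
  filter_upwards [isOpen_ball.mem_nhds ht] with u hu
  rw [hcauchy _ (hF u hu), hcircle]
  rfl

/-- Continuous partial derivatives give joint differentiability; the chain rule along the diagonal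
follows. -/
theorem hasDerivAt_diag {F F₁ F₂ : ℂ → ℂ → ℂ} {t : ℂ}
    (h₁ : ∀ᶠ x : ℂ × ℂ in 𝓝 (t, t), HasDerivAt (fun u => F u x.2) (F₁ x.1 x.2) x.1)
    (h₂ : ∀ᶠ x : ℂ × ℂ in 𝓝 (t, t), HasDerivAt (fun u => F x.1 u) (F₂ x.1 x.2) x.2)
    (hc₁ : ContinuousAt (fun x : ℂ × ℂ => F₁ x.1 x.2) (t, t))
    (hc₂ : ContinuousAt (fun x : ℂ × ℂ => F₂ x.1 x.2) (t, t)) :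
    HasDerivAt (fun u => F u u) (F₁ t t + F₂ t t) t := by
  let L : ℂ → ℂ →L[ℂ] ℂ := fun c => ContinuousLinearMap.toSpanSingleton ℂ c
  have hL : Continuous L := by
    refine continuous_clm_apply.mpr fun z => ?_
    simp only [L, ContinuousLinearMap.toSpanSingleton_apply, smul_eq_mul]
    fun_prop
  have h := hasStrictFDerivAt_uncurry_coprod (u := (t, t)) (f := F)
    (f₁ := fun a b => L (F₁ a b)) (f₂ := fun a b => L (F₂ a b))
    (by filter_upwards [h₁] with x hx using hx.hasFDerivAt)
    (by filter_upwards [h₂] with x hx using hx.hasFDerivAt)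
    (hL.continuousAt.comp hc₁) (hL.continuousAt.comp hc₂)
  have h2 := HasFDerivAt.comp_hasDerivAt (f := fun u : ℂ => (u, u)) t h.hasFDerivAt
    ((hasDerivAt_id t).prodMk (hasDerivAt_id t))
  convert! h2 using 1
  simp [L, Function.HasUncurry.uncurry]

open Metric Filter in
/-- Existence of solutions of holomorphic autonomous differential equations. -/
theorem exists_hasDerivAt_complex {E : Type*} [NormedAddCommGroup E] [NormedSpace ℂ E]
    [CompleteSpace E] {V : E → E} (hV : ContDiffAt ℂ 1 V 0) :
    ∃ r > 0, ∃ a : ℂ → E, a 0 = 0 ∧ ∀ t ∈ ball (0 : ℂ) r, HasDerivAt a (V (a t)) t := by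
  obtain ⟨K, s, hs, hK⟩ := hV.exists_lipschitzOnWith
  have hdiff : ∀ᶠ x in 𝓝 (0 : E), DifferentiableAt ℂ V x := by
    filter_upwards [hV.eventually (by simp)] with x hx using hx.differentiableAt one_ne_zero
  obtain ⟨R, hR, hRs⟩ := nhds_basis_closedBall.mem_iff.mp (Filter.inter_mem hs hdiff)
  have hLip : ∀ x ∈ closedBall (0 : E) R, ∀ y ∈ closedBall (0 : E) R,
      ‖V x - V y‖ ≤ K * ‖x - y‖ := fun x hx y hy => by
    simpa [dist_eq_norm] using hK.dist_le_mul x (hRs hx).1 y (hRs hy).1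
  set B : ℝ := ‖V 0‖ + K * R + 1 with hB
  have hBpos : 0 < B := by positivity
  have hbound : ∀ x ∈ closedBall (0 : E) R, ‖V x‖ ≤ B := fun x hx => by
    have h1 := hLip x hx 0 (mem_closedBall_self hR.le)
    have h2 : ‖x‖ ≤ R := by simpa using hx
    have h3 := norm_le_norm_add_norm_sub' (V x) (V 0)
    rw [sub_zero] at h1
    nlinarith [mul_le_mul_of_nonneg_left h2 K.coe_nonneg]
  -- The first bound keeps the Picard iterates in the ball of radius `R`; the second makes the
  -- iteration a contraction with factor `1 / 2`.
  obtain ⟨r, hr, hrB, hrK⟩ : ∃ r > 0, r * B ≤ R ∧ r * K ≤ 1 / 2 := by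
    refine ⟨min (R / B) (1 / (2 * (K + 1))), by positivity, ?_, ?_⟩
    · calc _ ≤ R / B * B := by gcongr; exact min_le_left _ _
        _ = R := by field_simp
    · calc _ ≤ 1 / (2 * (K + 1)) * (K + 1 : ℝ) := by
            gcongr
            · exact min_le_right _ _
            · linarith
        _ = 1 / 2 := by field_simp
  let P : Type _ := {a : ℂ → E // DifferentiableOn ℂ a (ball 0 r) ∧ a 0 = 0 ∧
    ∀ t ∈ ball (0 : ℂ) r, a t ∈ closedBall (0 : E) R}
  have hstep : ∀ a : P, ∃ b : P, ∀ t ∈ ball (0 : ℂ) r, HasDerivAt b.1 (V (a.1 t)) t := by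
    rintro ⟨a, had, ha0, haR⟩
    have h1 : DifferentiableOn ℂ (fun t => V (a t)) (ball 0 r) := fun t ht =>
      ((hRs (haR t ht)).2.comp t (had.differentiableAt (isOpen_ball.mem_nhds ht))
        ).differentiableWithinAt
    -- The Picard step takes a holomorphic primitive on the disc.
    obtain ⟨b, hb0, hb⟩ := h1.isExactOn_ball.with_val_at 0 0
    refine ⟨⟨b, fun t ht => (hb t ht).differentiableAt.differentiableWithinAt, hb0, ?_⟩, hb⟩
    intro t ht
    have h2 := (convex_ball (0 : ℂ) r).norm_image_sub_le_of_norm_hasDerivWithin_le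
      (fun u hu => (hb u hu).hasDerivWithinAt) (fun u hu => hbound _ (haR u hu))
      (mem_ball_self hr) ht
    rw [hb0, sub_zero, sub_zero] at h2
    have h3 : ‖t‖ < r := by simpa using ht
    rw [mem_closedBall_zero_iff]
    nlinarith
  choose next hnext using hstep
  let a₀ : P := ⟨fun _ => 0, differentiableOn_const _, rfl, fun _ _ => mem_closedBall_self hR.le⟩
  let a : ℕ → P := fun n => next^[n] a₀
  have ha (n) : ∀ t ∈ ball (0 : ℂ) r, HasDerivAt (a (n + 1)).1 (V ((a n).1 t)) t := by
    simp only [a, Function.iterate_succ_apply']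
    exact hnext _
  -- The bound is `R / 2 ^ n`, written in the shape `C / 2 / 2 ^ n` that
  -- `cauchySeq_of_le_geometric_two` expects, with `C = 2 * R`.
  have hdist : ∀ n, ∀ t ∈ ball (0 : ℂ) r,
      ‖(a (n + 1)).1 t - (a n).1 t‖ ≤ 2 * R / 2 / 2 ^ n := by
    intro n
    induction n with
    | zero =>
      intro t ht
      have h1 := (a 1).2.2.2 t ht
      rw [mem_closedBall_zero_iff] at h1
      have h2 : (a 0).1 t = 0 := rfl
      rw [h2]
      simpa using h1
    | succ n ih =>
      intro t ht
      have h2 := (convex_ball (0 : ℂ) r).norm_image_sub_le_of_norm_hasDerivWithin_le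
        (C := K * (2 * R / 2 / 2 ^ n))
        (fun u hu => ((ha (n + 1) u hu).sub (ha n u hu)).hasDerivWithinAt)
        (fun u hu => (hLip _ ((a (n + 1)).2.2.2 u hu) _ ((a n).2.2.2 u hu)).trans
          (mul_le_mul_of_nonneg_left (ih u hu) K.coe_nonneg))
        (mem_ball_self hr) ht
      have h3 : ‖t‖ < r := by simpa using ht
      simp only [Pi.sub_apply, (a (n + 2)).2.2.1, (a (n + 1)).2.2.1, sub_zero] at h2
      refine h2.trans ?_
      have h4 : (0 : ℝ) ≤ 2 * R / 2 / 2 ^ n := by positivity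
      calc K * (2 * R / 2 / 2 ^ n) * ‖t‖ ≤ K * (2 * R / 2 / 2 ^ n) * r := by gcongr
        _ = r * K * (2 * R / 2 / 2 ^ n) := by ring
        _ ≤ 1 / 2 * (2 * R / 2 / 2 ^ n) := by gcongr
        _ = _ := by rw [pow_succ]; ring
  have hdist' : ∀ t ∈ ball (0 : ℂ) r, ∀ n,
      dist ((a n).1 t) ((a (n + 1)).1 t) ≤ 2 * R / 2 / 2 ^ n := fun t ht n => by
    rw [dist_comm, dist_eq_norm]
    exact hdist n t ht
  have hlim : ∀ t : ℂ, ∃ l, t ∈ ball (0 : ℂ) r → Tendsto (fun n => (a n).1 t) atTop (𝓝 l) := by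
    intro t
    by_cases ht : t ∈ ball (0 : ℂ) r
    · obtain ⟨l, hl⟩ := cauchySeq_tendsto_of_complete (cauchySeq_of_le_geometric_two (hdist' t ht))
      exact ⟨l, fun _ => hl⟩
    · exact ⟨0, fun h => absurd h ht⟩
  choose l hl using hlim
  have hlR : ∀ t ∈ ball (0 : ℂ) r, l t ∈ closedBall (0 : E) R := fun t ht =>
    isClosed_closedBall.mem_of_tendsto (hl t ht)
      (Eventually.of_forall fun n => (a n).2.2.2 t ht)
  have hunif : TendstoUniformlyOn (fun n t => V ((a n).1 t)) (fun t => V (l t)) atTop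
      (ball 0 r) := by
    rw [tendstoUniformlyOn_iff]
    intro ε hε
    have h1 : Tendsto (fun n : ℕ => K * (2 * R / 2 ^ n)) atTop (𝓝 (K * 0)) := by
      refine Tendsto.const_mul _ ?_
      have := (tendsto_pow_atTop_nhds_zero_of_lt_one (r := (1 / 2 : ℝ)) (by norm_num)
        (by norm_num)).const_mul (2 * R)
      simpa [div_eq_mul_inv] using this
    rw [mul_zero] at h1
    filter_upwards [h1.eventually (gt_mem_nhds hε)] with n hn t ht
    refine lt_of_le_of_lt ?_ hn
    rw [dist_comm, dist_eq_norm]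
    refine (hLip _ ((a n).2.2.2 t ht) _ (hlR t ht)).trans ?_
    gcongr
    rw [← dist_eq_norm]
    exact dist_le_of_le_geometric_two_of_tendsto (hdist' t ht) (hl t ht) n
  refine ⟨r, hr, l, ?_, fun t ht => ?_⟩
  · refine tendsto_nhds_unique (hl 0 (mem_ball_self hr)) ?_
    simp [fun n => (a n).2.2.1]
  · exact hasDerivAt_of_tendstoLocallyUniformlyOn isOpen_ball hunif.tendstoLocallyUniformlyOn
      (f := fun n => (a (n + 1)).1) (Eventually.of_forall ha)
      (fun x hx => (tendsto_add_atTop_iff_nat 1).mpr (hl x hx)) ht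

end

/-! ### Families of birational maps and the adjoint action. -/

noncomputable section

namespace ProjectiveManifold

variable {M : ProjectiveManifold}
variable {E : Type*} [NormedAddCommGroup E] [NormedSpace ℂ E]

theorem value_sum {ι : Type*} (s : Finset ι) (f : ι → M.RatFunc) {p : M.Point}
    (hf : ∀ i ∈ s, M.IsRegularAt (f i) p) :
    M.IsRegularAt (∑ i ∈ s, f i) p ∧ M.value (∑ i ∈ s, f i) p = ∑ i ∈ s, M.value (f i) p := by
  classical
  induction s using Finset.induction_on with
  | empty => simpa using ⟨isRegularAt_zero p, value_zero p⟩
  | insert a s ha ih =>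
    have h1 := ih fun i hi => hf i (Finset.mem_insert_of_mem hi)
    have h2 := hf a (Finset.mem_insert_self a s)
    rw [Finset.sum_insert ha, Finset.sum_insert ha]
    exact ⟨h2.add h1.1, by rw [value_add h2 h1.1, h1.2]⟩

/-- All vector fields in the range of `ρ` are holomorphic at the points of `O`. -/
def HolomorphicOn (ρ : E →ₗ[ℂ] M.RatVectorField) (O : Set M.Point) : Prop :=
  ∀ p ∈ O, ∀ y, M.IsHolomorphicAt (ρ y) p

section

variable {ρ : E →ₗ[ℂ] M.RatVectorField} {O : Set M.Point}

/-- A finite basis separates the dependence on `y` from that on `p`, so continuity and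
differentiability can be checked factor by factor. -/
theorem HolomorphicOn.value_eq_sum [FiniteDimensional ℂ E] (hO : HolomorphicOn ρ O) {p : M.Point}
    (hp : p ∈ O)
    {h : M.RatFunc} (hh : M.IsRegularAt h p) (y : E) :
    M.value (ρ y h) p = ∑ i, (Module.finBasis ℂ E).coord i y *
      M.value (ρ (Module.finBasis ℂ E i) h) p := by
  have h1 : ρ y h = ∑ i, (Module.finBasis ℂ E).coord i y • ρ (Module.finBasis ℂ E i) h := by
    conv_lhs => rw [← (Module.finBasis ℂ E).sum_repr y]
    rw [map_sum, ← Derivation.coeFnAddMonoidHom_apply, map_sum, Finset.sum_apply]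
    simp
  rw [h1, (value_sum _ _ fun i _ => (hO p hp _ h hh).smul _).2]
  exact Finset.sum_congr rfl fun i _ => value_smul _ (hO p hp _ h hh)

theorem HolomorphicOn.continuousAt_value [FiniteDimensional ℂ E] (hO : HolomorphicOn ρ O)
    (hopen : IsOpen O)
    {T : Type*} [TopologicalSpace T] {y : T → E} {γ : T → M.Point} {x : T}
    (hy : ContinuousAt y x) (hγ : ContinuousAt γ x) (hx : γ x ∈ O) {h : M.RatFunc}
    (hh : M.IsRegularAt h (γ x)) : ContinuousAt (fun u => M.value (ρ (y u) h) (γ u)) x := by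
  have h1 : (fun u => M.value (ρ (y u) h) (γ u)) =ᶠ[𝓝 x] fun u =>
      ∑ i, (Module.finBasis ℂ E).coord i (y u) * M.value (ρ (Module.finBasis ℂ E i) h) (γ u) := by
    filter_upwards [hγ.eventually (hopen.mem_nhds hx), hγ.eventually hh.eventually] with u hu1 hu2
    exact hO.value_eq_sum hu1 hu2 _
  refine ContinuousAt.congr ?_ h1.symm
  refine tendsto_finsetSum _ fun i _ => ?_
  refine ContinuousAt.mul ?_ ((hO _ hx _ h hh).continuousAt_value.comp hγ)
  exact ((Module.finBasis ℂ E).coord i).continuous_of_finiteDimensional.continuousAt.comp hy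

/-- Leibniz rule: one term comes from the variation of the field, the other from the motion of the
point. -/
theorem HolomorphicOn.hasDerivAt_value [FiniteDimensional ℂ E] (hO : HolomorphicOn ρ O)
    (hopen : IsOpen O)
    {y : ℂ → E} {y' x : E} {γ : ℂ → M.Point} {t : ℂ}
    (hy : HasDerivAt y y' t) (hγ : ContinuousAt γ t) (ht : γ t ∈ O)
    (hd : ∀ f, M.IsRegularAt f (γ t) →
      HasDerivAt (fun s => M.value f (γ s)) (M.value (ρ x f) (γ t)) t)
    {h : M.RatFunc} (hh : M.IsRegularAt h (γ t)) :
    HasDerivAt (fun s => M.value (ρ (y s) h) (γ s))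
      (M.value (ρ y' h) (γ t) + M.value (ρ x (ρ (y t) h)) (γ t)) t := by
  set b := Module.finBasis ℂ E
  have h1 : (fun s => M.value (ρ (y s) h) (γ s)) =ᶠ[𝓝 t] fun s =>
      ∑ i, b.coord i (y s) * M.value (ρ (b i) h) (γ s) := by
    filter_upwards [hγ.eventually (hopen.mem_nhds ht), hγ.eventually hh.eventually] with u hu1 hu2
    exact hO.value_eq_sum hu1 hu2 _
  have hcoord (i) : HasDerivAt (fun s => b.coord i (y s)) (b.coord i y') t :=
    (LinearMap.toContinuousLinearMap (b.coord i)).hasFDerivAt.comp_hasDerivAt t hy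
  have h2 := HasDerivAt.fun_sum (u := Finset.univ) fun i _ =>
    (hcoord i).mul (hd _ (hO _ ht (b i) h hh))
  refine (h2.congr_of_eventuallyEq h1).congr_deriv ?_
  rw [Finset.sum_add_distrib, hO.value_eq_sum ht hh]
  congr 1
  have h3 : ρ x (ρ (y t) h) = ∑ i, b.coord i (y t) • ρ x (ρ (b i) h) := by
    conv_lhs => rw [← b.sum_repr (y t)]
    rw [map_sum, ← Derivation.coeFnAddMonoidHom_apply (∑ i, _), map_sum, Finset.sum_apply, map_sum]
    simp
  have h4 (i) : M.IsRegularAt (ρ x (ρ (b i) h)) (γ t) := hO _ ht _ _ (hO _ ht _ h hh)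
  rw [h3, (value_sum _ _ fun i _ => (h4 i).smul _).2]
  exact Finset.sum_congr rfl fun i _ => (value_smul _ (h4 i)).symm

/-- A family `β` of birational transformations, starting with the identity, and acting on points
near `O` through `ψ`, whose velocity at time `t` is the vector field `ρ (v t)`. -/
structure IsFamily (ρ : E →ₗ[ℂ] M.RatVectorField) (O : Set M.Point) (β : ℂ → M.Bir)
    (U : Set (ℂ × M.Point)) (ψ : ℂ → M.Point → M.Point) (v : ℂ → E) : Prop where
  isOpen : IsOpen U
  zero_mem : ∀ p ∈ O, ((0 : ℂ), p) ∈ U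
  one : β 0 = 1
  map_zero : ∀ p ∈ O, ψ 0 p = p
  continuousOn : ContinuousOn (fun x : ℂ × M.Point => ψ x.1 x.2) U
  mem : ∀ t p, (t, p) ∈ U → ψ t p ∈ O
  maps : ∀ t p, (t, p) ∈ U → M.MapsPoint (β t) p (ψ t p)
  hasDerivAt : ∀ t p, (t, p) ∈ U → ∀ f, M.IsRegularAt f (ψ t p) →
    HasDerivAt (fun s => M.value f (ψ s p)) (M.value (ρ (v t) f) (ψ t p)) t

variable {β β' : ℂ → M.Bir} {U U' : Set (ℂ × M.Point)} {ψ ψ' : ℂ → M.Point → M.Point}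
  {v v' : ℂ → E}

theorem IsFamily.continuousAt (hβ : IsFamily ρ O β U ψ v) {x : ℂ × M.Point} (hx : x ∈ U) :
    ContinuousAt (fun x : ℂ × M.Point => ψ x.1 x.2) x :=
  hβ.continuousOn.continuousAt (hβ.isOpen.mem_nhds hx)

theorem IsFamily.continuousAt_left (hβ : IsFamily ρ O β U ψ v) {t : ℂ} {p : M.Point}
    (hx : (t, p) ∈ U) : ContinuousAt (fun s => ψ s p) t :=
  ContinuousAt.comp (f := fun s : ℂ => (s, p)) (hβ.continuousAt hx) (by fun_prop)

open Metric in
/-- The two flows can be composed at `p`, for times smaller than `r`. -/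
def Composable (U U' : Set (ℂ × M.Point)) (ψ' : ℂ → M.Point → M.Point)
    (r : ℝ) (p : M.Point) : Prop :=
  ∀ t ∈ ball (0 : ℂ) r, ∀ s ∈ ball (0 : ℂ) r, (s, p) ∈ U' ∧ (t, ψ' s p) ∈ U

/-- The radii are restricted to a sequence so that the resulting cover of `O` is countable, as
`exists_zariski_dense` requires. -/
theorem IsFamily.exists_composable (hβ : IsFamily ρ O β U ψ v) (hβ' : IsFamily ρ O β' U' ψ' v')
    {p : M.Point} (hp : p ∈ O) :
    ∃ n : ℕ, Composable U U' ψ' (1 / ((n : ℝ) + 1)) p := by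
  have h1 : ∀ᶠ x : ℂ × ℂ in 𝓝 (0, 0), (x.2, p) ∈ U' ∧ (x.1, ψ' x.2 p) ∈ U := by
    have hc : ContinuousAt (fun x : ℂ × ℂ => (x.2, p)) (0, 0) := by fun_prop
    have hc' : ContinuousAt (fun x : ℂ × ℂ => (x.1, ψ' x.2 p)) (0, 0) := by
      refine ContinuousAt.prodMk (by fun_prop) ?_
      exact ContinuousAt.comp (f := fun x : ℂ × ℂ => (x.2, p))
        (hβ'.continuousAt (hβ'.zero_mem p hp)) hc
    refine (hc.eventually (hβ'.isOpen.mem_nhds (hβ'.zero_mem p hp))).and (hc'.eventually ?_)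
    refine hβ.isOpen.mem_nhds ?_
    simp only [hβ'.map_zero p hp]
    exact hβ.zero_mem p hp
  obtain ⟨r, hr, hball⟩ := Metric.eventually_nhds_iff_ball.mp h1
  obtain ⟨n, hn⟩ := exists_nat_one_div_lt hr
  refine ⟨n, fun t ht s hs => hball (t, s) ?_⟩
  rw [← ball_prod_same]
  exact ⟨Metric.ball_subset_ball hn.le ht, Metric.ball_subset_ball hn.le hs⟩

open Metric in
-- For fixed `p`, compare the derivative at `s = 0` of `h (ψ t (ψ' s p))` with the value at `ψ t p`
-- of the transported field applied to `h`. They agree at `t = 0`, and the time derivative of each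
-- is the same expression with `ρ x h` in place of `h`.
theorem IsFamily.value_derivation_pullback [FiniteDimensional ℂ E] (hopen : IsOpen O)
    (hO : HolomorphicOn ρ O)
    {x x' : E}
    (hβ : IsFamily ρ O β U ψ fun _ => x) (hβ' : IsFamily ρ O β' U' ψ' fun _ => x')
    {C : E →L[ℂ] E} (hC : ∀ y, ρ (C y) = ⁅ρ x, ρ y⁆) {p : M.Point} (hp : p ∈ O) {r : ℝ}
    (hr : 0 < r) (hgood : Composable U U' ψ' r p) {h : M.RatFunc}
    (hh : ∀ q ∈ O, M.IsRegularAt h q) {t : ℂ} (ht : t ∈ ball (0 : ℂ) r) :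
    M.IsRegularAt (ρ x' (pullback (β t).val h) -
      pullback (β t).val (ρ (NormedSpace.exp (t • (-C)) x') h)) p ∧
    M.value (ρ x' (pullback (β t).val h) -
      pullback (β t).val (ρ (NormedSpace.exp (t • (-C)) x') h)) p = 0 := by
  have h0 : (0 : ℂ) ∈ ball (0 : ℂ) r := mem_ball_self hr
  have hU' {s : ℂ} (hs : s ∈ ball (0 : ℂ) r) : (s, p) ∈ U' := (hgood 0 h0 s hs).1
  have hψ'0 : ψ' 0 p = p := hβ'.map_zero p hp
  have hU {t : ℂ} (ht : t ∈ ball (0 : ℂ) r) : (t, p) ∈ U := by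
    have := (hgood t ht 0 h0).2
    rwa [hψ'0] at this
  -- This class of functions is stable under `ρ x`, which makes the simultaneous Taylor argument
  -- possible.
  let I := {h : M.RatFunc // ∀ q ∈ O, M.IsRegularAt h q}
  let D : I → I := fun h => ⟨ρ x h.1, fun q hq => hO q hq x _ (h.2 q hq)⟩
  let F : I → ℂ → ℂ → ℂ := fun h t s => M.value h.1 (ψ t (ψ' s p))
  let e : ℂ → E →L[ℂ] E := fun t => NormedSpace.exp (t • (-C))
  have hFs (h : I) {t s : ℂ} (ht : t ∈ ball (0 : ℂ) r) (hs : s ∈ ball (0 : ℂ) r) :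
      HasDerivAt (F h t) (M.value (ρ x' (pullback (β t).val h.1)) (ψ' s p)) s := by
    have hq := (hgood t ht s hs).2
    have h1 : (F h t) =ᶠ[𝓝 s] fun s => M.value (pullback (β t).val h.1) (ψ' s p) := by
      filter_upwards [isOpen_ball.mem_nhds hs] with u hu
      have hu' := (hgood t ht u hu).2
      exact ((hβ.maps _ _ hu').value_pullback (h.2 _ (hβ.mem _ _ hu'))).symm
    refine HasDerivAt.congr_of_eventuallyEq ?_ h1
    exact hβ'.hasDerivAt s p (hU' hs) _ ((hβ.maps _ _ hq).isRegularAt (h.2 _ (hβ.mem _ _ hq)))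
  have hFt (h : I) {t s : ℂ} (ht : t ∈ ball (0 : ℂ) r) (hs : s ∈ ball (0 : ℂ) r) :
      HasDerivAt (fun u => F h u s) (F (D h) t s) t := by
    have hq := (hgood t ht s hs).2
    exact hβ.hasDerivAt t _ hq h.1 (h.2 _ (hβ.mem _ _ hq))
  have hFc (h : I) : ContinuousOn (fun x : ℂ × ℂ => F h x.1 x.2) (ball 0 r ×ˢ ball 0 r) := by
    rintro ⟨t, s⟩ ⟨ht, hs⟩
    apply ContinuousAt.continuousWithinAt
    have hq := (hgood t ht s hs).2
    refine ContinuousAt.comp (f := fun x : ℂ × ℂ => ψ x.1 (ψ' x.2 p)) (x := (t, s))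
      (h.2 _ (hβ.mem _ _ hq)).continuousAt_value ?_
    refine ContinuousAt.comp (f := fun x : ℂ × ℂ => (x.1, ψ' x.2 p)) (x := (t, s))
      (hβ.continuousAt hq) ?_
    refine ContinuousAt.prodMk (by fun_prop) ?_
    exact ContinuousAt.comp (f := fun x : ℂ × ℂ => x.2) (x := (t, s))
      (hβ'.continuousAt_left (hU' hs)) (by fun_prop)
  have hG (h : I) {t : ℂ} (ht : t ∈ ball (0 : ℂ) r) :
      HasDerivAt (fun u => deriv (F h u) 0) (deriv (F (D h) t) 0) t :=
    hasDerivAt_deriv_of_hasDerivAt hr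
      (fun t ht s hs => (hFs h ht hs).differentiableAt.differentiableWithinAt)
      (fun t ht s hs => (hFs (D h) ht hs).differentiableAt.differentiableWithinAt)
      (hFc (D h)) (fun t ht s hs => hFt h ht hs) ht
  have he (t : ℂ) : HasDerivAt (fun u => e u x') (-C (e t x')) t := by
    have h1 := hasDerivAt_exp_smul_const' (𝕂 := ℂ) (-C) t
    have h2 := (ContinuousLinearMap.apply ℂ E x').hasFDerivAt.comp_hasDerivAt t h1
    exact h2
  let R : I → ℂ → ℂ := fun h t => M.value (ρ (e t x') h.1) (ψ t p)
  have hR (h : I) {t : ℂ} (ht : t ∈ ball (0 : ℂ) r) : HasDerivAt (R h) (R (D h) t) t := by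
    have hq := hβ.mem _ _ (hU ht)
    have h1 := hO.hasDerivAt_value hopen (he t) (hβ.continuousAt_left (hU ht)) hq
      (hβ.hasDerivAt t p (hU ht)) (h.2 _ hq)
    refine h1.congr_deriv ?_
    rw [← value_add (hO _ hq _ _ (h.2 _ hq)) (hO _ hq _ _ (hO _ hq _ _ (h.2 _ hq)))]
    congr 1
    -- With `X = ρ x` and `Y = ρ (e t x')`, this is `-[X, Y] h + X (Y h) = Y (X h)`; the sign in
    -- `exp (-t C)` is chosen for this cancellation.
    rw [map_neg, hC, Derivation.neg_apply, Derivation.commutator_apply]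
    change _ = ρ (e t x') (ρ x h.1)
    abel
  have hzero : deriv (F ⟨h, hh⟩ t) 0 - R ⟨h, hh⟩ t = 0 := by
    refine eq_zero_of_forall_hasDerivAt (fun (h : I) t => deriv (F h t) 0 - R h t) D
      (fun h t ht => (hG h ht).sub (hR h ht)) (fun h => ?_) ⟨h, hh⟩ ht
    have h1 := (hFs h h0 h0).deriv
    rw [h1, hβ.one, Units.val_one, pullback_one, hψ'0, RingHom.id_apply, sub_eq_zero]
    simp only [R, e, zero_smul, NormedSpace.exp_zero, hβ.map_zero p hp]
    rfl
  have hq := hβ.mem _ _ (hU ht)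
  have hmaps := hβ.maps _ _ (hU ht)
  have hreg1 : M.IsRegularAt (ρ x' (pullback (β t).val h)) p :=
    hO p hp _ _ (hmaps.isRegularAt (hh _ hq))
  have hreg2 : M.IsRegularAt (ρ (e t x') h) (ψ t p) := hO _ hq _ _ (hh _ hq)
  refine ⟨hreg1.sub (hmaps.isRegularAt hreg2), ?_⟩
  rw [value_sub hreg1 (hmaps.isRegularAt hreg2), hmaps.value_pullback hreg2]
  rw [(hFs ⟨h, hh⟩ ht h0).deriv, hψ'0] at hzero
  exact hzero

theorem derivation_map_eq_of_affine {A : M.scheme.Opens} (hA : IsAffineOpen A)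
    (hη : genericPoint M.scheme ∈ A) (α : M.RatFunc →+* M.RatFunc) (X Y : M.RatVectorField)
    (h : ∀ f : Γ(M.scheme, A), X (α (M.scheme.presheaf.germ A _ hη f)) =
      α (Y (M.scheme.presheaf.germ A _ hη f))) (f : M.RatFunc) : X (α f) = α (Y f) := by
  have : Nonempty A := ⟨⟨_, hη⟩⟩
  have := functionField_isFractionRing_of_isAffineOpen M.scheme A hA
  obtain ⟨a, b, hb, rfl⟩ := IsFractionRing.div_surjective Γ(M.scheme, A) f
  have ha : X (α (algebraMap Γ(M.scheme, A) M.RatFunc a)) =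
    α (Y (algebraMap Γ(M.scheme, A) M.RatFunc a)) := h a
  have hb' : X (α (algebraMap Γ(M.scheme, A) M.RatFunc b)) =
    α (Y (algebraMap Γ(M.scheme, A) M.RatFunc b)) := h b
  rw [map_div₀, Derivation.leibniz_div, Derivation.leibniz_div, ha, hb']
  simp

/-- The adjoint action: conjugation by the flow of `ρ x` is the exponential of the bracket. -/
theorem IsFamily.exists_derivation_pullback [FiniteDimensional ℂ E] (hopen : IsOpen O)
    (hO : HolomorphicOn ρ O)
    {A W : M.scheme.Opens} (hA : IsAffineOpen A) (hAO : ∀ p ∈ O, p.pt ∈ A)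
    (hW : (W : Set M.scheme).Nonempty) (hWO : ∀ p : M.Point, p.pt ∈ W → p ∈ O) {x x' : E}
    (hβ : IsFamily ρ O β U ψ fun _ => x) (hβ' : IsFamily ρ O β' U' ψ' fun _ => x')
    {C : E →L[ℂ] E} (hC : ∀ y, ρ (C y) = ⁅ρ x, ρ y⁆) :
    ∃ r > 0, ∀ t ∈ Metric.ball (0 : ℂ) r, ∀ h, ρ x' (pullback (β t).val h) =
      pullback (β t).val (ρ (NormedSpace.exp (t • (-C)) x') h) := by
  -- The composition time depends on the point; density of one set of the cover gives a single
  -- radius.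
  obtain ⟨n, hn⟩ := exists_zariski_dense hW
    (fun n : ℕ => {p | Composable U U' ψ' (1 / ((n : ℝ) + 1)) p})
    (fun p hp => hβ.exists_composable hβ' (hWO p hp))
  refine ⟨1 / ((n : ℝ) + 1), by positivity, fun t ht h => ?_⟩
  obtain ⟨q, hq⟩ := exists_point_mem hW
  have hη : genericPoint M.scheme ∈ A := genericPoint_mem (hAO q (hWO q hq))
  refine derivation_map_eq_of_affine hA hη _ (ρ x') (ρ (NormedSpace.exp (t • (-C)) x')) ?_ h
  intro f
  rw [← sub_eq_zero]
  refine hn _ fun p hp hpW => ?_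
  exact hβ.value_derivation_pullback hopen hO hβ' hC (hWO p hpW) (by positivity) hp
    (fun q hq => (isRegularAt_germ hη f q (hAO q hq)).1) ht

end

end ProjectiveManifold
end

/-! ### Reparametrization and products of families. -/

noncomputable section

namespace ProjectiveManifold

variable {M : ProjectiveManifold}
variable {E : Type*} [NormedAddCommGroup E] [NormedSpace ℂ E]
variable {ρ : E →ₗ[ℂ] M.RatVectorField} {O : Set M.Point}
variable {β β' : ℂ → M.Bir} {U U' : Set (ℂ × M.Point)} {ψ ψ' : ℂ → M.Point → M.Point}
  {v v' : ℂ → E}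

theorem IsFamily.congr (hβ : IsFamily ρ O β U ψ v) (h : ∀ t p, (t, p) ∈ U → v t = v' t) :
    IsFamily ρ O β U ψ v' where
  __ := hβ
  hasDerivAt t p hp f hf := by
    rw [← h t p hp]
    exact hβ.hasDerivAt t p hp f hf

open Metric in
theorem IsFamily.one_family (ρ : E →ₗ[ℂ] M.RatVectorField) (hopen : IsOpen O) {r : ℝ}
    (hr : 0 < r) : IsFamily ρ O (fun _ => 1) (ball 0 r ×ˢ O) (fun _ p => p) (fun _ => 0) where
  isOpen := isOpen_ball.prod hopen
  zero_mem p hp := ⟨mem_ball_self hr, hp⟩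
  one := rfl
  map_zero _ _ := rfl
  continuousOn := continuous_snd.continuousOn
  mem _ _ h := h.2
  maps _ p _ := MapsPoint.one p
  hasDerivAt t p _ f _ := by
    rw [_root_.map_zero, Derivation.zero_apply, value_zero]
    exact hasDerivAt_const _ _

open Metric in
theorem IsFamily.reparametrize {x : E} (hO : HolomorphicOn ρ O)
    (hβ : IsFamily ρ O β U ψ fun _ => x) {a a' : ℂ → ℂ} {r : ℝ}
    (hr : 0 < r) (ha0 : a 0 = 0) (ha : ∀ t ∈ ball (0 : ℂ) r, HasDerivAt a (a' t) t) :
    IsFamily ρ O (fun t => β (a t)) (ball (0 : ℂ) r ×ˢ Set.univ ∩ {z | (a z.1, z.2) ∈ U})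
      (fun t p => ψ (a t) p) (fun t => a' t • x) := by
  have hc : ContinuousOn (fun z : ℂ × M.Point => (a z.1, z.2)) (ball (0 : ℂ) r ×ˢ Set.univ) := by
    refine ContinuousOn.prodMk ?_ continuous_snd.continuousOn
    exact ContinuousOn.comp (t := ball (0 : ℂ) r)
      (fun t ht => (ha t ht).continuousAt.continuousWithinAt)
      continuous_fst.continuousOn (fun z hz => hz.1)
  refine ⟨hc.isOpen_inter_preimage (isOpen_ball.prod isOpen_univ) hβ.isOpen, fun p hp => ?_, ?_,
    fun p hp => ?_, ?_, fun t p h => hβ.mem _ _ h.2, fun t p h => hβ.maps _ _ h.2, ?_⟩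
  · refine ⟨⟨mem_ball_self hr, trivial⟩, ?_⟩
    change (a 0, p) ∈ U
    rw [ha0]
    exact hβ.zero_mem p hp
  · rw [ha0, hβ.one]
  · rw [ha0, hβ.map_zero p hp]
  · exact hβ.continuousOn.comp (hc.mono Set.inter_subset_left) fun z hz => hz.2
  · rintro t p ⟨⟨ht, -⟩, hU⟩ f hf
    have h1 := HasDerivAt.comp t (hβ.hasDerivAt (a t) p hU f hf) (ha t ht)
    refine h1.congr_deriv ?_
    rw [map_smul, Derivation.smul_apply, value_smul _ (hO _ (hβ.mem _ _ hU) _ _ hf), mul_comm]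

open Metric in
-- Differentiate `f (ψ a (ψ' b p))` separately in `a` and `b`, then restrict to the diagonal. The
-- operator `A t` carries the inner velocity past `β t`.
theorem IsFamily.mul [FiniteDimensional ℂ E] (hopen : IsOpen O) (hO : HolomorphicOn ρ O)
    (hβ : IsFamily ρ O β U ψ v) (hβ' : IsFamily ρ O β' U' ψ' v') {r : ℝ} (hr : 0 < r)
    (hv : ContinuousOn v (ball 0 r)) (hv' : ContinuousOn v' (ball 0 r))
    {A : ℂ → E →L[ℂ] E} (hA : ContinuousOn A (ball 0 r))
    (hAd : ∀ t ∈ ball (0 : ℂ) r, ∀ y h,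
      ρ y (pullback (β t).val h) = pullback (β t).val (ρ (A t y) h)) :
    IsFamily ρ O (fun t => β t * β' t)
      ((ball (0 : ℂ) r ×ˢ Set.univ ∩ U') ∩ {z | (z.1, ψ' z.1 z.2) ∈ U})
      (fun t p => ψ t (ψ' t p)) (fun t => v t + A t (v' t)) := by
  have hopen' : IsOpen (ball (0 : ℂ) r ×ˢ (Set.univ : Set M.Point) ∩ U') :=
    (isOpen_ball.prod isOpen_univ).inter hβ'.isOpen
  have hc : ContinuousOn (fun z : ℂ × M.Point => (z.1, ψ' z.1 z.2))
      (ball (0 : ℂ) r ×ˢ (Set.univ : Set M.Point) ∩ U') :=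
    continuous_fst.continuousOn.prodMk (hβ'.continuousOn.mono Set.inter_subset_right)
  refine ⟨hc.isOpen_inter_preimage hopen' hβ.isOpen, fun p hp => ?_, ?_, fun p hp => ?_, ?_,
    fun t p h => hβ.mem _ _ h.2, fun t p h => (hβ'.maps _ _ h.1.2).comp (hβ.maps _ _ h.2), ?_⟩
  · refine ⟨⟨⟨mem_ball_self hr, trivial⟩, hβ'.zero_mem p hp⟩, ?_⟩
    change ((0 : ℂ), ψ' 0 p) ∈ U
    rw [hβ'.map_zero p hp]
    exact hβ.zero_mem p hp
  · rw [hβ.one, hβ'.one, mul_one]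
  · rw [hβ'.map_zero p hp, hβ.map_zero p hp]
  · exact hβ.continuousOn.comp (hc.mono Set.inter_subset_left) fun z hz => hz.2
  · rintro t p ⟨⟨⟨ht, -⟩, hU'⟩, hU⟩ f hf
    change (t, ψ' t p) ∈ U at hU
    have hball : ball (0 : ℂ) r ∈ 𝓝 t := isOpen_ball.mem_nhds ht
    have hc1 : ContinuousAt (fun z : ℂ × ℂ => (z.1, ψ' z.2 p)) (t, t) :=
      ContinuousAt.prodMk (by fun_prop) (ContinuousAt.comp (f := fun z : ℂ × ℂ => z.2) (x := (t, t))
        (hβ'.continuousAt_left hU') (by fun_prop))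
    have hcψ : ContinuousAt (fun z : ℂ × ℂ => ψ z.1 (ψ' z.2 p)) (t, t) :=
      ContinuousAt.comp (f := fun z : ℂ × ℂ => (z.1, ψ' z.2 p)) (x := (t, t))
        (hβ.continuousAt hU) hc1
    have hev : ∀ᶠ z : ℂ × ℂ in 𝓝 (t, t), (z.1 ∈ ball (0 : ℂ) r ∧ z.2 ∈ ball (0 : ℂ) r) ∧
        ((z.2, p) ∈ U' ∧ (z.1, ψ' z.2 p) ∈ U) ∧ M.IsRegularAt f (ψ z.1 (ψ' z.2 p)) := by
      have h1 : ∀ᶠ z : ℂ × ℂ in 𝓝 (t, t), z ∈ ball (0 : ℂ) r ×ˢ ball (0 : ℂ) r :=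
        prod_mem_nhds hball hball
      have h2 : ContinuousAt (fun z : ℂ × ℂ => (z.2, p)) (t, t) := by fun_prop
      filter_upwards [h1, h2.preimage_mem_nhds (hβ'.isOpen.mem_nhds hU'),
        hc1.preimage_mem_nhds (hβ.isOpen.mem_nhds hU), hcψ.preimage_mem_nhds hf.eventually]
        with z h1 h2 h3 h4 using ⟨h1, ⟨h2, h3⟩, h4⟩
    have hq : ψ t (ψ' t p) ∈ O := hβ.mem _ _ hU
    have h := hasDerivAt_diag (F := fun a b => M.value f (ψ a (ψ' b p)))
      (F₁ := fun a b => M.value (ρ (v a) f) (ψ a (ψ' b p)))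
      (F₂ := fun a b => M.value (ρ (A a (v' b)) f) (ψ a (ψ' b p))) (t := t) ?_ ?_ ?_ ?_
    · refine h.congr_deriv ?_
      rw [map_add, Derivation.add_apply, value_add (hO _ hq _ _ hf) (hO _ hq _ _ hf)]
    · filter_upwards [hev] with z hz
      exact hβ.hasDerivAt _ _ hz.2.1.2 f hz.2.2
    · filter_upwards [eventually_eventually_nhds.mpr hev] with z hz
      have hz0 := hz.self_of_nhds
      have h1 : ∀ᶠ b in 𝓝 z.2, (z.1, ψ' b p) ∈ U ∧ M.IsRegularAt f (ψ z.1 (ψ' b p)) := by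
        have : ContinuousAt (fun b : ℂ => (z.1, b)) z.2 := by fun_prop
        filter_upwards [this.eventually hz] with b hb using ⟨hb.2.1.2, hb.2.2⟩
      have h2 : (fun b => M.value f (ψ z.1 (ψ' b p))) =ᶠ[𝓝 z.2]
          fun b => M.value (pullback (β z.1).val f) (ψ' b p) := by
        filter_upwards [h1] with b hb
        exact ((hβ.maps _ _ hb.1).value_pullback hb.2).symm
      refine HasDerivAt.congr_of_eventuallyEq ?_ h2
      have hm := hβ.maps _ _ hz0.2.1.2
      refine (hβ'.hasDerivAt _ _ hz0.2.1.1 _ (hm.isRegularAt hz0.2.2)).congr_deriv ?_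
      -- The inner family differentiates the pulled back function; the adjoint relation moves the
      -- field outside the pull-back, to the final point.
      rw [hAd _ hz0.1.1]
      exact hm.value_pullback (hO _ (hβ.mem _ _ hz0.2.1.2) _ _ hz0.2.2)
    · refine hO.continuousAt_value hopen ?_ hcψ hq hf
      exact ContinuousAt.comp (f := fun z : ℂ × ℂ => z.1) (x := (t, t))
        (hv.continuousAt hball) (by fun_prop)
    · refine hO.continuousAt_value hopen ?_ hcψ hq hf
      refine ContinuousAt.clm_apply ?_ ?_
      · exact ContinuousAt.comp (f := fun z : ℂ × ℂ => z.1) (x := (t, t))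
          (hA.continuousAt hball) (by fun_prop)
      · exact ContinuousAt.comp (f := fun z : ℂ × ℂ => z.2) (x := (t, t))
          (hv'.continuousAt hball) (by fun_prop)

end ProjectiveManifold

/-! ### Prescribing the velocity of a product. -/

section

variable {E : Type*} [NormedAddCommGroup E] [NormedSpace ℂ E]
  {ι : Type*}

/-- The velocity of the product of the one-parameter families with generators `x i` and adjoint
actions `exp (-t C i)`, at the times `a i`, as a function of the velocities of the `a i`. -/
def productVelocity (x : ι → E) (C : ι → E →L[ℂ] E) :
    List ι → (ι → ℂ) → (ι → ℂ) →L[ℂ] E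
  | [], _ => 0
  | i :: L, a => (ContinuousLinearMap.proj (R := ℂ) (φ := fun _ : ι => ℂ) i).smulRight (x i) +
      (NormedSpace.exp (a i • (-C i))).comp (productVelocity x C L a)

theorem productVelocity_cons_apply (x : ι → E) (C : ι → E →L[ℂ] E) (i : ι) (L : List ι)
    (a b : ι → ℂ) : productVelocity x C (i :: L) a b =
      b i • x i + NormedSpace.exp (a i • (-C i)) (productVelocity x C L a b) := rfl

theorem productVelocity_zero (x : ι → E) (C : ι → E →L[ℂ] E) (L : List ι) (b : ι → ℂ) :
    productVelocity x C L 0 b = (L.map fun i => b i • x i).sum := by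
  induction L with
  | nil => rfl
  | cons i L ih =>
    rw [productVelocity_cons_apply, ih]
    simp

theorem contDiff_productVelocity [Fintype ι] [CompleteSpace E] (x : ι → E) (C : ι → E →L[ℂ] E)
    (L : List ι) :
    ContDiff ℂ 1 (productVelocity x C L) := by
  induction L with
  | nil => exact contDiff_const
  | cons i L ih =>
    refine contDiff_const.add (ContDiff.clm_comp ?_ ih)
    have h1 : ContDiff ℂ 1 (NormedSpace.exp : (E →L[ℂ] E) → E →L[ℂ] E) := by
      rw [contDiff_iff_contDiffAt]
      exact fun y => (NormedSpace.exp_analytic (𝕂 := ℂ) y).contDiffAt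
    exact h1.comp ((contDiff_apply ℂ ℂ i).smul contDiff_const)

open Metric in
-- At the origin the velocity map is onto because the `x i` span, so it has a linear section.
-- Composed with this section it stays invertible nearby, and the requirement becomes an explicit
-- equation for `a`.
theorem exists_productVelocity_eq [Fintype ι] [FiniteDimensional ℂ E] (x : ι → E)
    (C : ι → E →L[ℂ] E)
    (hx : Submodule.span ℂ (Set.range x) = ⊤) (y : E) {R : ℝ} (hR : 0 < R) :
    ∃ r > 0, ∃ a a' : ι → ℂ → ℂ, (∀ i, a i 0 = 0) ∧
      (∀ i, ∀ t ∈ ball (0 : ℂ) r, HasDerivAt (a i) (a' i t) t) ∧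
      (∀ i, ContinuousOn (a' i) (ball 0 r)) ∧ (∀ i, ∀ t ∈ ball (0 : ℂ) r, a i t ∈ ball 0 R) ∧
      ∀ t ∈ ball (0 : ℂ) r, productVelocity x C Finset.univ.toList (fun i => a i t)
        (fun i => a' i t) = y := by
  have : CompleteSpace E := FiniteDimensional.complete ℂ E
  set D := productVelocity x C Finset.univ.toList with hD
  have hD0 (b) : D 0 b = ∑ i, b i • x i := by
    rw [hD, productVelocity_zero, Finset.sum_map_toList]
  have hsurj : LinearMap.range (D 0).toLinearMap = ⊤ := by
    rw [eq_top_iff, ← hx, Submodule.span_le]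
    rintro _ ⟨i, rfl⟩
    classical
    exact ⟨Pi.single i 1, by simp [hD0, Pi.single_apply]⟩
  obtain ⟨σ, hσ⟩ := (D 0).toLinearMap.exists_rightInverse_of_surjective hsurj
  let σ' : E →L[ℂ] (ι → ℂ) := LinearMap.toContinuousLinearMap σ
  let B : (ι → ℂ) → E →L[ℂ] E := fun a => (D a).comp σ'
  have hB : ContDiff ℂ 1 B := (contDiff_productVelocity x C _).clm_comp contDiff_const
  have hB0 : B 0 = 1 := ContinuousLinearMap.ext fun z => congr($hσ z)
  -- A solution of `a' = V a` satisfies `D a (a') = B a (B a)⁻¹ y = y` wherever `B a` is invertible.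
  let V : (ι → ℂ) → (ι → ℂ) := fun a => σ' (Ring.inverse (B a) y)
  have hV : ContDiffAt ℂ 1 V 0 := by
    have h1 : ContDiffAt ℂ 1 Ring.inverse (B 0) := by
      rw [hB0]
      exact contDiffAt_ringInverse ℂ (1 : (E →L[ℂ] E)ˣ)
    exact σ'.contDiff.contDiffAt.comp 0 ((h1.comp 0 hB.contDiffAt).clm_apply contDiffAt_const)
  obtain ⟨r, hr, a, ha0, ha⟩ := exists_hasDerivAt_complex hV
  have hunit : ∀ᶠ b in 𝓝 (0 : ι → ℂ), IsUnit (B b) := by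
    refine hB.continuous.continuousAt.eventually (Units.isOpen.mem_nhds ?_)
    rw [hB0]
    exact isUnit_one
  have hcont : ∀ᶠ b in 𝓝 (0 : ι → ℂ), ContinuousAt V b := by
    filter_upwards [hV.eventually (by simp)] with b hb using hb.continuousAt
  have hbound : ∀ᶠ b in 𝓝 (0 : ι → ℂ), ∀ i, b i ∈ ball (0 : ℂ) R := by
    filter_upwards [ball_mem_nhds (0 : ι → ℂ) hR] with b hb i
    rw [mem_ball_zero_iff] at hb ⊢
    exact (norm_le_pi_norm b i).trans_lt hb
  have hac : ContinuousAt a 0 := (ha 0 (mem_ball_self hr)).continuousAt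
  have hev := hac.eventually (by rw [ha0]; exact hunit.and (hcont.and hbound))
  obtain ⟨r', hr', hball⟩ := Metric.eventually_nhds_iff_ball.mp hev
  have hle {t : ℂ} (ht : t ∈ ball (0 : ℂ) (min r r')) : t ∈ ball (0 : ℂ) r :=
    ball_subset_ball (min_le_left _ _) ht
  have hle' {t : ℂ} (ht : t ∈ ball (0 : ℂ) (min r r')) : t ∈ ball (0 : ℂ) r' :=
    ball_subset_ball (min_le_right _ _) ht
  refine ⟨min r r', lt_min hr hr', fun i t => a t i, fun i t => V (a t) i, fun i => congrFun ha0 i,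
    fun i t ht => hasDerivAt_pi.mp (ha t (hle ht)) i, fun i t ht => ?_,
    fun i t ht => (hball t (hle' ht)).2.2 i, fun t ht => ?_⟩
  · refine ContinuousAt.continuousWithinAt ?_
    have h1 : ContinuousAt (fun u => V (a u)) t :=
      ContinuousAt.comp (g := V) (hball t (hle' ht)).2.1 (ha t (hle ht)).continuousAt
    exact (continuous_apply i).continuousAt.comp h1
  · have h1 := Ring.mul_inverse_cancel (B (a t)) (hball t (hle' ht)).1
    exact congr($h1 y)

end

/-! ### Products of finitely many birational flows. -/

namespace ProjectiveManifold

variable {M : ProjectiveManifold}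
variable {E : Type*} [NormedAddCommGroup E] [NormedSpace ℂ E] [FiniteDimensional ℂ E]
variable {ρ : E →ₗ[ℂ] M.RatVectorField} {O : Set M.Point}

open Metric in
-- Each new factor is put on the left, so the adjoint action is needed only for single flows, and
-- the velocity follows the recursion of `productVelocity`.
theorem exists_isFamily_list (hopen : IsOpen O) (hO : HolomorphicOn ρ O) {ι : Type*} [Fintype ι]
    {x : ι → E} {C : ι → E →L[ℂ] E} {β : ι → ℂ → M.Bir} {U : ι → Set (ℂ × M.Point)}
    {ψ : ι → ℂ → M.Point → M.Point} (hβ : ∀ i, IsFamily ρ O (β i) (U i) (ψ i) fun _ => x i)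
    {R : ℝ} (hAd : ∀ i, ∀ t ∈ ball (0 : ℂ) R, ∀ y h, ρ y (pullback (β i t).val h) =
      pullback (β i t).val (ρ (NormedSpace.exp (t • (-C i)) y) h))
    {r : ℝ} (hr : 0 < r) {a a' : ι → ℂ → ℂ} (ha0 : ∀ i, a i 0 = 0)
    (ha : ∀ i, ∀ t ∈ ball (0 : ℂ) r, HasDerivAt (a i) (a' i t) t)
    (ha' : ∀ i, ContinuousOn (a' i) (ball 0 r)) (haR : ∀ i, ∀ t ∈ ball (0 : ℂ) r, a i t ∈ ball 0 R)
    (L : List ι) :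
    ∃ U' ψ', IsFamily ρ O (fun t => (L.map fun i => β i (a i t)).prod) U' ψ'
      (fun t => productVelocity x C L (fun i => a i t) (fun i => a' i t)) ∧
      ∀ t p, (t, p) ∈ U' → t ∈ ball (0 : ℂ) r := by
  have : CompleteSpace E := FiniteDimensional.complete ℂ E
  have hac (i) : ContinuousOn (a i) (ball 0 r) :=
    fun t ht => (ha i t ht).continuousAt.continuousWithinAt
  induction L with
  | nil => exact ⟨_, _, IsFamily.one_family ρ hopen hr, fun t p h => h.1⟩
  | cons i L ih =>
    obtain ⟨U', ψ', hfam, -⟩ := ih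
    have h1 := (hβ i).reparametrize hO hr (ha0 i) (ha i)
    have hexp : Continuous fun c : ℂ => NormedSpace.exp (c • (-C i)) :=
      continuous_iff_continuousAt.mpr fun c =>
        (hasDerivAt_exp_smul_const' (𝕂 := ℂ) (-C i) c).continuousAt
    refine ⟨_, _, h1.mul hopen hO hfam hr ((ha' i).smul continuousOn_const) ?_
      (A := fun t => NormedSpace.exp (a i t • (-C i))) (hexp.comp_continuousOn (hac i))
      (fun t ht y h => hAd i _ (haR i t ht) y h), fun t p h => h.1.1.1⟩
    refine ContinuousOn.clm_apply ?_ (continuousOn_pi.mpr ha')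
    exact (contDiff_productVelocity x C L).continuous.comp_continuousOn (continuousOn_pi.mpr hac)

end ProjectiveManifold
end

noncomputable section

/-! ### Extension of local homomorphisms -/

open Metric in
/-- A local homomorphism from a disc of `ℂ` to a group extends to `ℂ`. -/
theorem exists_monoidHom_eq_on_ball {G : Type*} [Group G] {β : ℂ → G} {r : ℝ} (hr : 0 < r)
    (hβ : ∀ t ∈ ball (0 : ℂ) r, ∀ s ∈ ball (0 : ℂ) r, β (t + s) = β t * β s) :
    ∃ φ : Multiplicative ℂ →* G, ∀ t ∈ ball (0 : ℂ) r, φ (Multiplicative.ofAdd t) = β t := by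
  have h0 : β 0 = 1 := by
    have := hβ 0 (mem_ball_self hr) 0 (mem_ball_self hr)
    rw [add_zero] at this
    exact left_eq_mul.mp this
  have hpow : ∀ (k : ℕ) (u : ℂ), (k : ℂ) * u ∈ ball (0 : ℂ) r → β (k * u) = β u ^ k := by
    intro k u
    induction k with
    | zero => intro _; simpa using h0
    | succ k ih =>
      intro hk
      rw [mem_ball_zero_iff, norm_mul, Complex.norm_natCast] at hk
      push_cast at hk
      have hu : ‖u‖ < r := by nlinarith [norm_nonneg u, Nat.cast_nonneg (α := ℝ) k]
      have hku : (k : ℂ) * u ∈ ball (0 : ℂ) r := by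
        rw [mem_ball_zero_iff, norm_mul, Complex.norm_natCast]
        nlinarith [norm_nonneg u]
      rw [pow_succ, ← ih hku, ← hβ _ hku _ (by simpa using hu)]
      congr 1
      push_cast
      ring
  -- Both powers equal `β (t / (n * m)) ^ (n * m)`, so the extension does not depend on the
  -- subdivision.
  have hindep : ∀ (t : ℂ) (n m : ℕ), n ≠ 0 → m ≠ 0 → t / n ∈ ball (0 : ℂ) r →
      t / m ∈ ball (0 : ℂ) r → β (t / n) ^ n = β (t / m) ^ m := by
    intro t n m hn hm htn htm
    have hn' : (n : ℂ) ≠ 0 := Nat.cast_ne_zero.mpr hn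
    have hm' : (m : ℂ) ≠ 0 := Nat.cast_ne_zero.mpr hm
    have e1 : t / n = m * (t / (n * m)) := by field_simp
    have e2 : t / m = n * (t / (n * m)) := by field_simp
    have h1 : β (t / n) = β (t / (n * m)) ^ m := by
      conv_lhs => rw [e1]
      exact hpow _ _ (by rwa [← e1])
    have h2 : β (t / m) = β (t / (n * m)) ^ n := by
      conv_lhs => rw [e2]
      exact hpow _ _ (by rwa [← e2])
    rw [h1, h2, ← pow_mul, ← pow_mul, mul_comm m n]
  have hex : ∀ R : ℝ, ∃ n : ℕ, n ≠ 0 ∧ ∀ t : ℂ, ‖t‖ ≤ R → t / n ∈ ball (0 : ℂ) r := by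
    intro R
    obtain ⟨n, hn⟩ := exists_nat_gt (max R 0 / r)
    have hn0 : (0 : ℝ) < n := lt_of_le_of_lt (by positivity) hn
    refine ⟨n, by exact_mod_cast hn0.ne', fun t ht => ?_⟩
    rw [mem_ball_zero_iff, norm_div, Complex.norm_natCast, div_lt_iff₀ hn0]
    rw [div_lt_iff₀ hr] at hn
    linarith [le_max_left R 0]
  choose N hN0 hN using hex
  have hφ : ∀ (t : ℂ) (R : ℝ), ‖t‖ ≤ R → β (t / N ‖t‖) ^ N ‖t‖ = β (t / N R) ^ N R :=
    fun t R hR => hindep t _ _ (hN0 _) (hN0 _) (hN _ t le_rfl) (hN R t hR)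
  refine ⟨MonoidHom.mk' (fun t => β (t.toAdd / N ‖t.toAdd‖) ^ N ‖t.toAdd‖) ?_, ?_⟩
  · intro t s
    rw [toAdd_mul]
    generalize t.toAdd = t, s.toAdd = s
    -- A subdivision adapted to this bound serves `t`, `s` and `t + s` at once.
    set R := ‖t‖ + ‖s‖
    have ht : ‖t‖ ≤ R := le_add_of_nonneg_right (norm_nonneg s)
    have hs : ‖s‖ ≤ R := le_add_of_nonneg_left (norm_nonneg t)
    rw [hφ (t + s) R (norm_add_le t s), hφ t R ht, hφ s R hs, add_div,
      hβ _ (hN R t ht) _ (hN R s hs)]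
    refine Commute.mul_pow ?_ _
    rw [commute_iff_eq, ← hβ _ (hN R t ht) _ (hN R s hs), add_comm,
      hβ _ (hN R s hs) _ (hN R t ht)]
  · intro t ht
    change β (t / N ‖t‖) ^ N ‖t‖ = β t
    rw [hindep t _ 1 (hN0 _) one_ne_zero (hN _ t le_rfl) (by simpa using ht)]
    simp

/-! ### From constant velocity to birational integrability. -/

namespace ProjectiveManifold

variable {M : ProjectiveManifold}
variable {E : Type*} [NormedAddCommGroup E] [NormedSpace ℂ E]
variable {ρ : E →ₗ[ℂ] M.RatVectorField} {O : Set M.Point}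
variable {β : ℂ → M.Bir} {U : Set (ℂ × M.Point)} {ψ : ℂ → M.Point → M.Point}

theorem ringHom_eq_of_affine {A : M.scheme.Opens} (hA : IsAffineOpen A)
    (hη : genericPoint M.scheme ∈ A) {α α' : M.RatFunc →+* M.RatFunc}
    (h : ∀ f : Γ(M.scheme, A), α (M.scheme.presheaf.germ A _ hη f) =
      α' (M.scheme.presheaf.germ A _ hη f)) : α = α' := by
  have : Nonempty A := ⟨⟨_, hη⟩⟩
  have := functionField_isFractionRing_of_isAffineOpen M.scheme A hA
  exact IsFractionRing.ringHom_ext (A := Γ(M.scheme, A)) h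

open Metric in
/-- A family of birational transformations with constant velocity is a local homomorphism. -/
theorem IsFamily.exists_map_add (hO : HolomorphicOn ρ O)
    {A W : M.scheme.Opens} (hA : IsAffineOpen A) (hAO : ∀ p ∈ O, p.pt ∈ A)
    (hW : (W : Set M.scheme).Nonempty) (hWO : ∀ p : M.Point, p.pt ∈ W → p ∈ O) {x : E}
    (hβ : IsFamily ρ O β U ψ fun _ => x) :
    ∃ r > 0, ∀ t ∈ ball (0 : ℂ) r, ∀ s ∈ ball (0 : ℂ) r, β (t + s) = β t * β s := by
  obtain ⟨n, hn⟩ := exists_zariski_dense hW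
    (fun n : ℕ => {p | Composable U U ψ (1 / ((n : ℝ) + 1)) p})
    (fun p hp => hβ.exists_composable hβ (hWO p hp))
  set r : ℝ := 1 / ((n : ℝ) + 1) with hr
  have hr0 : 0 < r := by positivity
  -- Halving keeps `t + s` in the disc of radius `r`.
  refine ⟨r / 2, by positivity, fun t ht s hs => ?_⟩
  obtain ⟨q, hq⟩ := exists_point_mem hW
  have hη : genericPoint M.scheme ∈ A := genericPoint_mem (hAO q (hWO q hq))
  apply Units.ext
  apply pullback_injective
  refine ringHom_eq_of_affine hA hη fun f => ?_
  rw [← sub_eq_zero]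
  refine hn _ fun p hp hpW => ?_
  have hadd {u : ℂ} (hu : u ∈ ball (0 : ℂ) (r / 2)) : u + s ∈ ball (0 : ℂ) r := by
    rw [mem_ball_zero_iff] at hu hs ⊢
    linarith [norm_add_le u s]
  have hsub {u : ℂ} (hu : u ∈ ball (0 : ℂ) (r / 2)) : u ∈ ball (0 : ℂ) r :=
    ball_subset_ball (by linarith) hu
  have hU {u : ℂ} (hu : u ∈ ball (0 : ℂ) r) : (u, p) ∈ U := (hp 0 (mem_ball_self hr0) u hu).1
  have hU2 {u : ℂ} (hu : u ∈ ball (0 : ℂ) (r / 2)) : (u, ψ s p) ∈ U :=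
    (hp u (hsub hu) s (hsub hs)).2
  let I := {h : M.RatFunc // ∀ q ∈ O, M.IsRegularAt h q}
  let D : I → I := fun h => ⟨ρ x h.1, fun q hq => hO q hq x _ (h.2 q hq)⟩
  have hf (q) (hq : q ∈ O) : M.IsRegularAt (M.scheme.presheaf.germ A _ hη f) q :=
    (isRegularAt_germ hη f q (hAO q hq)).1
  -- Uniqueness of solutions in Taylor form: both curves in `u` follow `ρ x` and start at `ψ s p`.
  have hzero := eq_zero_of_forall_hasDerivAt
    (fun (h : I) u => M.value h.1 (ψ (u + s) p) - M.value h.1 (ψ u (ψ s p))) D (r := r / 2)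
    (fun h u hu => by
      refine HasDerivAt.sub ?_ (hβ.hasDerivAt _ _ (hU2 hu) _ (h.2 _ (hβ.mem _ _ (hU2 hu))))
      exact (hβ.hasDerivAt _ _ (hU (hadd hu)) _ (h.2 _ (hβ.mem _ _ (hU (hadd hu))))).comp_add_const
        u s)
    (fun h => by
      rw [zero_add, hβ.map_zero _ (hβ.mem _ _ (hU (hsub hs))), sub_self]) ⟨_, hf⟩ ht
  have hm1 := hβ.maps _ _ (hU (hadd ht))
  have hm2 := (hβ.maps _ _ (hU (hsub hs))).comp (hβ.maps _ _ (hU2 ht))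
  have hf1 := hf _ (hβ.mem _ _ (hU (hadd ht)))
  have hf2 := hf _ (hβ.mem _ _ (hU2 ht))
  refine ⟨(hm1.isRegularAt hf1).sub (hm2.isRegularAt hf2), ?_⟩
  rw [value_sub (hm1.isRegularAt hf1) (hm2.isRegularAt hf2), hm1.value_pullback hf1,
    hm2.value_pullback hf2]
  exact hzero

open Metric in
theorem IsFamily.isBirationallyIntegrable (hopen : IsOpen O) (hO : HolomorphicOn ρ O)
    {A W : M.scheme.Opens} (hA : IsAffineOpen A) (hAO : ∀ p ∈ O, p.pt ∈ A)
    (hW : (W : Set M.scheme).Nonempty) (hWO : ∀ p : M.Point, p.pt ∈ W → p ∈ O) {x : E}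
    (hβ : IsFamily ρ O β U ψ fun _ => x) : M.IsBirationallyIntegrable (ρ x) := by
  obtain ⟨r, hr, hadd⟩ := hβ.exists_map_add hO hA hAO hW hWO
  obtain ⟨φ, hφ⟩ := exists_monoidHom_eq_on_ball hr hadd
  -- Time slices become unions of discs centred at zero, hence connected; `ε ≤ r` keeps them where
  -- `φ` agrees with `β`.
  let U' : Set (ℂ × M.Point) := {z | ∃ ε ≤ r, ∃ V : Set M.Point, IsOpen V ∧ V ⊆ O ∧
    ball (0 : ℂ) ε ×ˢ V ⊆ U ∧ z ∈ ball (0 : ℂ) ε ×ˢ V}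
  have hsub : U' ⊆ U := by
    rintro z ⟨ε, -, V, -, -, h1, h2⟩
    exact h1 h2
  have hball {t p} (h : (t, p) ∈ U') : t ∈ ball (0 : ℂ) r := by
    obtain ⟨ε, hε, V, -, -, -, h2⟩ := h
    exact ball_subset_ball hε h2.1
  have hmemO {t p} (h : (t, p) ∈ U') : p ∈ O := by
    obtain ⟨ε, hε, V, -, h1, -, h2⟩ := h
    exact h1 h2.2
  have hopen' : IsOpen U' := by
    rw [isOpen_iff_forall_mem_open]
    rintro z ⟨ε, hε, V, hV, hVO, h1, h2⟩
    exact ⟨ball 0 ε ×ˢ V, fun w hw => ⟨ε, hε, V, hV, hVO, h1, hw⟩, isOpen_ball.prod hV, h2⟩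
  have hzero {p} (hp : p ∈ O) : ((0 : ℂ), p) ∈ U' := by
    obtain ⟨B, V, hB, hV, h0, hpV, hBV⟩ := isOpen_prod_iff.mp hβ.isOpen 0 p (hβ.zero_mem p hp)
    obtain ⟨ε, hε, hεB⟩ := Metric.isOpen_iff.mp hB 0 h0
    exact ⟨min ε r, min_le_right _ _, V ∩ O, hV.inter hopen, Set.inter_subset_right,
      (Set.prod_mono ((ball_subset_ball (min_le_left _ _)).trans hεB)
        Set.inter_subset_left).trans hBV, mem_ball_self (lt_min hε hr), hpV, hp⟩
  refine ⟨φ, U', ψ, ⟨hopen', W, hW, fun p hp => hzero (hWO p hp)⟩,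
    ⟨fun t p h => hzero (hmemO h), fun p => ?_, hβ.continuousOn.mono hsub,
      fun p hp => hβ.map_zero p (hmemO hp), fun t p h => ?_⟩, fun t p h => ?_⟩
  · refine isPreconnected_of_forall 0 fun t ht => ?_
    obtain ⟨ε, hε, V, hV, hVO, h1, h2⟩ := ht
    exact ⟨ball 0 ε, fun s hs => ⟨ε, hε, V, hV, hVO, h1, hs, h2.2⟩,
      mem_ball_self (dist_nonneg.trans_lt h2.1), h2.1, (convex_ball 0 ε).isPreconnected⟩
  · exact ⟨hβ.continuousAt_left (hsub h), hO _ (hβ.mem _ _ (hsub h)) x,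
      hβ.hasDerivAt _ _ (hsub h)⟩
  · rw [hφ t (hball h)]
    exact hβ.maps _ _ (hsub h)

end ProjectiveManifold
end

/-! ### The adjoint action on the whole algebra, and conclusion. -/

noncomputable section

namespace ProjectiveManifold

variable {M : ProjectiveManifold}

theorem pullback_smul (f : M.DominantRatMap) (c : ℂ) (h : M.RatFunc) :
    pullback f (c • h) = c • pullback f h := by
  have hconst : CommRingCat.ofHom (M.constGerm (genericPoint M.scheme)) ≫ pullbackHom f =
      CommRingCat.ofHom (M.constGerm (genericPoint M.scheme)) := by
    obtain ⟨g, hg⟩ := f.toRationalMap.exists_rep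
    have hover : g.IsOver (Spec (CommRingCat.of ℂ)) := by
      rw [← Scheme.PartialMap.isOver_toRationalMap_iff_of_isSeparated, hg]
      exact f.isOver
    apply Spec.map_injective
    have h1 : g.hom ≫ M.str = g.domain.ι ≫ M.str := hover.1
    have h2 : f.toRationalMap.fromFunctionField = g.fromFunctionField := by rw [← hg]; rfl
    rw [Spec.map_comp, specMap_constGerm, reassoc_of% (specMap_pullbackHom f), h2,
      Scheme.PartialMap.fromFunctionField, Scheme.PartialMap.fromSpecStalkOfMem, Category.assoc,
      h1, Scheme.Opens.fromSpecStalkOfMem_ι_assoc]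
  have h3 : pullback f (algebraMap ℂ M.RatFunc c) = algebraMap ℂ M.RatFunc c := congr($hconst c)
  rw [Algebra.smul_def, map_mul, h3, ← Algebra.smul_def]

/-- Both sides are linear in `y`. Only the finitely many pairs of generators then need a radius, and
a common one exists. -/
theorem derivation_pullback_of_span_eq_top {E : Type*} [NormedAddCommGroup E] [NormedSpace ℂ E]
    {ρ : E →ₗ[ℂ] M.RatVectorField} {κ : Type*} {x : κ → E}
    (hx : Submodule.span ℂ (Set.range x) = ⊤) {f : M.DominantRatMap} (B : E →L[ℂ] E)
    (h : ∀ j h, ρ (x j) (pullback f h) = pullback f (ρ (B (x j)) h)) (y : E) (h' : M.RatFunc) :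
    ρ y (pullback f h') = pullback f (ρ (B y) h') := by
  have hy : y ∈ Submodule.span ℂ (Set.range x) := hx ▸ Submodule.mem_top
  induction hy using Submodule.span_induction with
  | mem y hy =>
    obtain ⟨j, rfl⟩ := hy
    exact h j h'
  | zero => simp
  | add y z _ _ hy hz => simp [hy, hz]
  | smul c y _ hy => simp [hy, pullback_smul]

section

variable {E : Type*} [NormedAddCommGroup E] [NormedSpace ℂ E] [FiniteDimensional ℂ E]
  {ρ : E →ₗ[ℂ] M.RatVectorField} {O : Set M.Point}
  {ι : Type*} [Finite ι] {x : ι → E} {C : ι → E →L[ℂ] E} {β : ι → ℂ → M.Bir}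
  {U : ι → Set (ℂ × M.Point)} {ψ : ι → ℂ → M.Point → M.Point}

/-- Over a common small disc, the pull-backs by the members of finitely many families whose
velocities span `E` act on the vector fields of `E` through the exponentials of the adjoint
operators. -/
theorem exists_forall_derivation_pullback (hopen : IsOpen O) (hO : HolomorphicOn ρ O)
    {A W : M.scheme.Opens} (hA : IsAffineOpen A) (hAO : ∀ p ∈ O, p.pt ∈ A)
    (hW : (W : Set M.scheme).Nonempty) (hWO : ∀ p : M.Point, p.pt ∈ W → p ∈ O)
    (hx : Submodule.span ℂ (Set.range x) = ⊤)
    (hβ : ∀ i, IsFamily ρ O (β i) (U i) (ψ i) fun _ => x i)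
    (hC : ∀ i y, ρ (C i y) = ⁅ρ (x i), ρ y⁆) :
    ∃ R > 0, ∀ i, ∀ t ∈ Metric.ball (0 : ℂ) R, ∀ y h, ρ y (pullback (β i t).val h) =
      pullback (β i t).val (ρ (NormedSpace.exp (t • (-C i)) y) h) := by
  have key (z : ι × ι) : ∀ᶠ R in 𝓝[>] (0 : ℝ), ∀ t ∈ Metric.ball (0 : ℂ) R, ∀ h,
      ρ (x z.2) (pullback (β z.1 t).val h) =
        pullback (β z.1 t).val (ρ (NormedSpace.exp (t • (-C z.1)) (x z.2)) h) := by
    obtain ⟨r, hr, h⟩ := (hβ z.1).exists_derivation_pullback hopen hO hA hAO hW hWO (hβ z.2)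
      (hC z.1)
    filter_upwards [Ioc_mem_nhdsGT hr] with R hR t ht
    exact h t (Metric.ball_subset_ball hR.2 ht)
  obtain ⟨R, hR, hRpos⟩ := ((Filter.eventually_all.mpr key).and self_mem_nhdsWithin).exists
  exact ⟨R, hRpos, fun i t ht y h =>
    derivation_pullback_of_span_eq_top hx _ (fun j h => hR (i, j) t ht h) y h⟩

/-- If finitely many birational flows generate a finite-dimensional Lie algebra, all of its
elements are birationally integrable. -/
theorem isBirationallyIntegrable_of_span_eq_top (hopen : IsOpen O) (hO : HolomorphicOn ρ O)
    {A W : M.scheme.Opens} (hA : IsAffineOpen A) (hAO : ∀ p ∈ O, p.pt ∈ A)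
    (hW : (W : Set M.scheme).Nonempty) (hWO : ∀ p : M.Point, p.pt ∈ W → p ∈ O)
    (hx : Submodule.span ℂ (Set.range x) = ⊤)
    (hβ : ∀ i, IsFamily ρ O (β i) (U i) (ψ i) fun _ => x i)
    (hC : ∀ i y, ρ (C i y) = ⁅ρ (x i), ρ y⁆) (y : E) : M.IsBirationallyIntegrable (ρ y) := by
  have := Fintype.ofFinite ι
  obtain ⟨R, hR, hAd⟩ := exists_forall_derivation_pullback hopen hO hA hAO hW hWO hx hβ hC
  obtain ⟨r, hr, a, a', ha0, ha, ha', haR, hv⟩ := exists_productVelocity_eq x C hx y hR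
  obtain ⟨U', ψ', hfam, hU'⟩ := exists_isFamily_list hopen hO hβ hAd hr ha0 ha ha' haR
    Finset.univ.toList
  exact (hfam.congr (v' := fun _ => y) fun t p hp =>
    hv t (hU' t p hp)).isBirationallyIntegrable hopen hO hA hAO hW hWO

end

theorem isHolomorphicAt_of_mem_span {S : Set M.RatVectorField} {p : M.Point}
    (hS : ∀ X ∈ S, M.IsHolomorphicAt X p) {X : M.RatVectorField}
    (hX : X ∈ Submodule.span ℂ S) : M.IsHolomorphicAt X p := by
  intro f hf
  induction hX using Submodule.span_induction with
  | mem X hX => exact hS X hX f hf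
  | zero => exact isRegularAt_zero p
  | add X Y _ _ hX hY => exact hX.add hY
  | smul c X _ hX => exact hX.smul c

theorem IsLocalFlowOn.isHolomorphicAt {X : M.RatVectorField} {U : Set (ℂ × M.Point)}
    {ψ : ℂ → M.Point → M.Point} (h : M.IsLocalFlowOn X U ψ) {p : M.Point}
    (hp : ((0 : ℂ), p) ∈ U) : M.IsHolomorphicAt X p := by
  simpa only [h.map_zero p hp] using (h.tangent 0 p hp).2.1

/-- The domain is cut down to the times and points whose image lies in `O`; this stays open by
continuity of the flow. -/
theorem IsLocalFlowOn.isFamily {E : Type*} [NormedAddCommGroup E] [NormedSpace ℂ E]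
    {ρ : E →ₗ[ℂ] M.RatVectorField} {O : Set M.Point} {x : E} {U : Set (ℂ × M.Point)}
    {ψ : ℂ → M.Point → M.Point} (h : M.IsLocalFlowOn (ρ x) U ψ) (hU : IsOpen U)
    (hopen : IsOpen O) (hOU : ∀ p ∈ O, ((0 : ℂ), p) ∈ U) {φ : Multiplicative ℂ →* M.Bir}
    (hφ : ∀ t p, (t, p) ∈ U → M.MapsPoint (φ (Multiplicative.ofAdd t)) p (ψ t p)) :
    IsFamily ρ O (fun t => φ (Multiplicative.ofAdd t))
      (U ∩ (fun z : ℂ × M.Point => ψ z.1 z.2) ⁻¹' O) ψ fun _ => x where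
  isOpen := h.continuousOn.isOpen_inter_preimage hU hopen
  zero_mem p hp := ⟨hOU p hp, by simpa [h.map_zero p (hOU p hp)] using hp⟩
  one := map_one φ
  map_zero p hp := h.map_zero p (hOU p hp)
  continuousOn := h.continuousOn.mono Set.inter_subset_left
  mem _ _ hp := hp.2
  maps t p hp := hφ t p hp.1
  hasDerivAt t p hp := (h.tangent t p hp.1).2.2

theorem exists_isAffineOpen (M : ProjectiveManifold) :
    ∃ A : M.scheme.Opens, IsAffineOpen A ∧ genericPoint M.scheme ∈ A := by
  obtain ⟨A, hA, hη, -⟩ := M.scheme.isBasis_affineOpens.exists_subset_of_mem_open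
    (Set.mem_univ (genericPoint M.scheme)) isOpen_univ
  obtain ⟨A, hA, rfl⟩ := hA
  exact ⟨A, hA, hη⟩

/-- A finite-dimensional Lie algebra of rational vector fields which is spanned by birationally
integrable ones consists of birationally integrable vector fields. -/
theorem subset_birVectorFields_of_span (g : LieSubalgebra ℂ M.RatVectorField)
    (hfin : FiniteDimensional ℂ g) (S : Set M.RatVectorField) (hS : S ⊆ M.birVectorFields)
    (hspan : g.toSubmodule = Submodule.span ℂ S) :
    (g : Set M.RatVectorField) ⊆ M.birVectorFields := by
  have hfg : (Submodule.span ℂ S).FG := by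
    rw [← hspan]
    exact Module.Finite.iff_fg.mp hfin
  obtain ⟨s, hsS, hs⟩ := (Submodule.fg_span_iff_fg_span_finset_subset S).mp hfg
  have hgs : g.toSubmodule = Submodule.span ℂ (s : Set M.RatVectorField) := hspan.trans hs
  have hmem (X : s) : (X : M.RatVectorField) ∈ g := by
    change (X : M.RatVectorField) ∈ g.toSubmodule
    rw [hgs]
    exact Submodule.subset_span X.2
  choose φ U ψ hadm hflow hmaps using fun X : s => hS (hsS X.2)
  choose hU W hW hWU using hadm
  -- Coordinates supply the norm needed for operator exponentials and differential equations.
  let e : (Fin (Module.finrank ℂ g) → ℂ) ≃ₗ[ℂ] g := (Module.finBasis ℂ g).equivFun.symm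
  let ρ : (Fin (Module.finrank ℂ g) → ℂ) →ₗ[ℂ] M.RatVectorField :=
    g.toSubmodule.subtype ∘ₗ e.toLinearMap
  let x (X : s) : Fin (Module.finrank ℂ g) → ℂ := e.symm ⟨X, hmem X⟩
  have hρx (X : s) : ρ (x X) = X := by simp [ρ, x]
  have hx : Submodule.span ℂ (Set.range x) = ⊤ := by
    have hinj : Function.Injective ρ := Subtype.val_injective.comp e.injective
    apply Submodule.map_injective_of_injective hinj
    rw [Submodule.map_span, ← Set.range_comp]
    have h1 : ρ ∘ x = Subtype.val := funext hρx
    rw [h1, Subtype.range_coe, Submodule.map_top]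
    refine hgs.symm.trans ?_
    rw [LinearMap.range_comp, LinearEquiv.range, Submodule.map_top, Submodule.range_subtype]
  let C (X : s) : (Fin (Module.finrank ℂ g) → ℂ) →L[ℂ] (Fin (Module.finrank ℂ g) → ℂ) :=
    LinearMap.toContinuousLinearMap
      (e.symm.toLinearMap ∘ₗ (LieAlgebra.ad ℂ g ⟨X, hmem X⟩) ∘ₗ e.toLinearMap)
  have hC (X : s) (y) : ρ (C X y) = ⁅ρ (x X), ρ y⁆ := by
    rw [hρx]
    simp [ρ, C]
  obtain ⟨A, hA, hηA⟩ := M.exists_isAffineOpen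
  -- Every generator has a flow at these points, so all of `g` is holomorphic there; the affine `A`
  -- provides enough regular functions to generate the function field.
  let O : Set M.Point := {p | p.pt ∈ A} ∩ ⋂ X : s, (fun p => ((0 : ℂ), p)) ⁻¹' U X
  have hopen : IsOpen O := (isOpen_setOf_mem A).inter
    (isOpen_iInter_of_finite fun X => (hU X).preimage (by fun_prop))
  have hOU {p} (hp : p ∈ O) (X : s) : ((0 : ℂ), p) ∈ U X := Set.mem_iInter.mp hp.2 X
  have hO : HolomorphicOn ρ O := by
    intro p hp y
    refine isHolomorphicAt_of_mem_span (S := (s : Set M.RatVectorField))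
      (fun X hX => (hflow ⟨X, hX⟩).isHolomorphicAt (hOU hp ⟨X, hX⟩)) ?_
    rw [← hgs]
    exact (e y).2
  let V : M.scheme.Opens := ⟨(A : Set M.scheme) ∩ ⋂ X, (W X : Set M.scheme),
    A.isOpen.inter (isOpen_iInter_of_finite fun X => (W X).isOpen)⟩
  have hV : (V : Set M.scheme).Nonempty :=
    ⟨genericPoint M.scheme, hηA, Set.mem_iInter.mpr fun X => genericPoint_mem (hW X).choose_spec⟩
  have hVO (p : M.Point) (hp : p.pt ∈ V) : p ∈ O :=
    ⟨hp.1, Set.mem_iInter.mpr fun X => hWU X p (Set.mem_iInter.mp hp.2 X)⟩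
  have hβ (X : s) := IsLocalFlowOn.isFamily (ρ := ρ) (x := x X) (hρx X ▸ hflow X) (hU X) hopen
    (fun p hp => hOU hp X) (hmaps X)
  intro X hX
  have h := isBirationallyIntegrable_of_span_eq_top hopen hO hA (fun p hp => hp.1) hV hVO hx hβ hC
    (e.symm ⟨X, hX⟩)
  rwa [show ρ (e.symm ⟨X, hX⟩) = X by simp [ρ]] at h

end ProjectiveManifold
end

theorem mainTheorem8 (M : ProjectiveManifold) (g : LieSubalgebra ℂ M.RatVectorField)
    (hfin : FiniteDimensional ℂ g) (S : Set M.RatVectorField) (hS : S ⊆ M.birVectorFields)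
    (hspan : g.toSubmodule = Submodule.span ℂ S) :
    (g : Set M.RatVectorField) ⊆ M.birVectorFields :=
  ProjectiveManifold.subset_birVectorFields_of_span g hfin S hS hspan
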